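/- **Notation.** For real matrices, $\|\cdot\|_F$ is the Frobenius norm, $\|\cdot\|$ the spectral norm, and $\langle X,Y\rangle={\rm trace}(X^{\mathbb T}Y)$. Let $M^*\in\mathbb{R}^{n\times m}$ have rank $r^*$ and let $r\ge r^*$. Let $f:\mathbb{R}^{n\times m}\to\mathbb{R}$ be twice continuously differentiable. For $0<\alpha\le\beta$, the function $f$ is said to satisfy the $(2r^*,4r^*)$-restricted strong convexity of modulus $\alpha$ and the $(2r^*,4r^*)$-restricted smoothness of modulus $\beta$ if $$\alpha\|H\|_F^2\le\nabla^2 f(X)(H,H)\le\beta\|H\|_F^2\quad\text{for all }X,H\in\mathbb{R}^{n\times m}\text{ with }{\rm rank}(X)\le 2r^*,\ {\rm rank}(H)\le 4r^*.$$ For $\lambda>0$, $U\in\mathbb{R}^{n\times r}$, $V\in\mathbb{R}^{m\times r}$ put $$\Phi_\lambda(U,V)=f(UV^{\mathbb T})+\tfrac{\lambda}{2}\big(\|U\|_F^2+\|V\|_F^2\big),\qquad W=\begin{pmatrix}U\\V\end{pmatrix},\qquad \Xi(X)=\begin{pmatrix}\lambda I&\nabla f(X)\\ \nabla f(X)^{\mathbb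 T}&\lambda I\end{pmatrix}.$$ Let $\mathcal{E}^*$ be the set of pairs $(P_1\Sigma^{1/2}R,\,Q_1\Sigma^{1/2}R)$, where $M^*=P\,{\rm Diag}(\sigma(M^*))\,Q^{\mathbb T}$ is any singular value decomposition with $P,Q$ orthogonal and nonincreasing singular values, $P_1,Q_1$ consist of the first $r^*$ columns of $P,Q$, $\Sigma={\rm Diag}(\sigma_1(M^*),\dots,\sigma_{r^*}(M^*))$, and $R$ is any orthogonal $r^*\times r^*$ matrix. For $(U^*,V^*)\in\mathcal{E}^*$ put $W^*=\begin{pmatrix}U^*\\V^*\end{pmatrix}$. **Theorem.** For all $\alpha,\beta$ with $0<\alpha\le\beta$ and $\beta/\alpha\le 1.38$ there is a constant $\widehat\gamma>0$, depending only on $\alpha$ and $\beta$, such that the following holds for all $n,m,r,r^*,M^*$ and $f$ as above. Suppose that $f$ satisfies the $(2r^*,4r^*)$-restricted strong convexity of modulus $\alpha$ and the $(2r^*,4r^*)$-restricted smoothness of modulus $\beta$. Then for every $\lambda>0$, every $(U^*,V^*)\in\mathcal{E}^*$ and every critical point $(U,V)$ of $\Phi_\lambda$ with ${\rm rank}(UV^{\mathbb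 T})\le r^*$ and positive semidefinite Hessian $\nabla^2\Phi_\lambda(U,V)$, $$2\|UV^{\mathbb T}-M^*\|_F^2\le\|WW^{\mathbb T}-W^*{W^*}^{\mathbb T}\|_F^2\le\widehat\gamma\, r^*\|\Xi(M^*)\|^2\le 2\widehat\gamma\, r^*\big[\lambda^2+\|\nabla f(M^*)\|^2\big].$$ -/

import Mathlib

-- Throughout, `‖A‖` for a real matrix `A` is the Frobenius norm; the spectral norm is `specNorm A`.
open scoped Matrix Matrix.Norms.Frobenius

noncomputable section

namespace LowRank

/-- The spectral norm of a real matrix: its operator norm between Euclidean spaces. -/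
def specNorm {I J : Type*} [Fintype I] [DecidableEq I] [Fintype J] [DecidableEq J]
    (A : Matrix I J ℝ) : ℝ :=
  ‖LinearMap.toContinuousLinearMap (Matrix.toEuclideanLin A)‖

/-- The first derivative `g'(x)(h)`. -/
def firstDeriv {E : Type*} [NormedAddCommGroup E] [NormedSpace ℝ E] (g : E → ℝ) (x h : E) : ℝ :=
  fderiv ℝ g x h

/-- The second derivative `∇²g(x)(h, k)`. -/
def hess {E : Type*} [NormedAddCommGroup E] [NormedSpace ℝ E] (g : E → ℝ) (x h k : E) : ℝ :=
  fderiv ℝ (fderiv ℝ g) x h k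

/-- The gradient of `f` at `X` for the trace inner product: the matrix of partial derivatives. -/
def grad {n m : ℕ} (f : Matrix (Fin n) (Fin m) ℝ → ℝ) (X : Matrix (Fin n) (Fin m) ℝ) :
    Matrix (Fin n) (Fin m) ℝ :=
  Matrix.of fun i j => firstDeriv f X (Matrix.single i j 1)

/-- `f` is twice continuously differentiable and satisfies the `(κ₁, κ₂)`-restricted strong
convexity of modulus `α` and the `(κ₁, κ₂)`-restricted smoothness of modulus `β`. -/
structure HasRSCRSS {n m : ℕ} (f : Matrix (Fin n) (Fin m) ℝ → ℝ) (κ₁ κ₂ : ℕ) (α β : ℝ) :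
    Prop where
  contDiff : ContDiff ℝ 2 f
  pos : 0 < α
  le : α ≤ β
  rsc : ∀ X H : Matrix (Fin n) (Fin m) ℝ, X.rank ≤ κ₁ → H.rank ≤ κ₂ →
    α * ‖H‖ ^ 2 ≤ hess f X H H
  rss : ∀ X H : Matrix (Fin n) (Fin m) ℝ, X.rank ≤ κ₁ → H.rank ≤ κ₂ →
    hess f X H H ≤ β * ‖H‖ ^ 2

/-- The factorized objective `Φ_λ(U, V) = f(UVᵀ) + (λ/2)(‖U‖_F² + ‖V‖_F²)`. -/
def Phi {n m r : ℕ} (f : Matrix (Fin n) (Fin m) ℝ → ℝ) (lam : ℝ)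
    (p : Matrix (Fin n) (Fin r) ℝ × Matrix (Fin m) (Fin r) ℝ) : ℝ :=
  f (p.1 * p.2ᵀ) + lam / 2 * (‖p.1‖ ^ 2 + ‖p.2‖ ^ 2)

/-- `(U, V)` is a critical point of `g` (meant for differentiable `g`). -/
def IsCritical {E : Type*} [NormedAddCommGroup E] [NormedSpace ℝ E] (g : E → ℝ) (x : E) : Prop :=
  fderiv ℝ g x = 0

/-- The Hessian of `g` at `x` is positive semidefinite. -/
def HessPSD {E : Type*} [NormedAddCommGroup E] [NormedSpace ℝ E] (g : E → ℝ) (x : E) : Prop :=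
  ∀ h : E, 0 ≤ hess g x h h

/-- The symmetric block matrix `Ξ(X) = [λI, ∇f(X); ∇f(X)ᵀ, λI]`. -/
def Xi {n m : ℕ} (f : Matrix (Fin n) (Fin m) ℝ → ℝ) (lam : ℝ) (X : Matrix (Fin n) (Fin m) ℝ) :
    Matrix (Fin n ⊕ Fin m) (Fin n ⊕ Fin m) ℝ :=
  Matrix.fromBlocks (lam • 1) (grad f X) (grad f X)ᵀ (lam • 1)

/-- The singular values of `X`, nonincreasing, indexed from `0` and extended by zeros. -/
def sing {n m : ℕ} (X : Matrix (Fin n) (Fin m) ℝ) (i : ℕ) : ℝ :=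
  (Matrix.toEuclideanLin X).singularValues i

/-- The rectangular diagonal matrix with diagonal `z`. -/
def rectDiag (n m : ℕ) (z : ℕ → ℝ) : Matrix (Fin n) (Fin m) ℝ :=
  Matrix.of fun i j => if (i : ℕ) = (j : ℕ) then z i else 0

/-- The pairs `(P, Q)` of orthogonal matrices with `X = P Diag(σ(X)) Qᵀ`. -/
def svdPairs {n m : ℕ} (X : Matrix (Fin n) (Fin m) ℝ) :
    Set (Matrix (Fin n) (Fin n) ℝ × Matrix (Fin m) (Fin m) ℝ) :=
  {PQ | PQ.1 ∈ Matrix.orthogonalGroup (Fin n) ℝ ∧ PQ.2 ∈ Matrix.orthogonalGroup (Fin m) ℝ ∧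
    X = PQ.1 * rectDiag n m (sing X) * PQ.2ᵀ}

/-- The set of balanced factor pairs `(P₁ Σ^{1/2} R, Q₁ Σ^{1/2} R)` of `M`, where `(P, Q)` is a
pair of orthogonal matrices of a singular value decomposition of `M`, `P₁` and `Q₁` are the first
`s` columns of `P` and `Q`, `Σ` is the diagonal matrix of the first `s` singular values of `M`, and
`R` is orthogonal. It is used with `s = rank M`, for which `s ≤ n` and `s ≤ m` hold. -/
def balancedFactors {n m : ℕ} (M : Matrix (Fin n) (Fin m) ℝ) (s : ℕ) :
    Set (Matrix (Fin n) (Fin s) ℝ × Matrix (Fin m) (Fin s) ℝ) :=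
  {UV | ∃ (hn : s ≤ n) (hm : s ≤ m), ∃ PQ ∈ svdPairs M, ∃ R ∈ Matrix.orthogonalGroup (Fin s) ℝ,
    UV.1 = PQ.1.submatrix id (Fin.castLE hn) *
      Matrix.diagonal (fun k : Fin s => √(sing M k)) * R ∧
    UV.2 = PQ.2.submatrix id (Fin.castLE hm) *
      Matrix.diagonal (fun k : Fin s => √(sing M k)) * R}

end LowRank

end

/-! Let W and B be the stacked factors of the critical point and of M, X = UVᵀ, E = WWᵀ − BBᵀ, P the
orthogonal projection onto the range of W, and x = √rs · ‖Ξ(M)‖.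

Balance. Stationarity along a direction that fixes UVᵀ to first order forces UᵀU = VᵀV
(`balanced_of_critical`). Hence W has rank at most rs, and 2‖X − M‖² ≤ ‖E‖² ≤ 4‖X − M‖².

First order. A variation (Y, Z) with [Y; Z]Wᵀ = EP correlates with X − M by at least ‖EP‖²/2
(`norm_sq_mul_projection_le`). Stationarity and the mixed Hessian bound `HasRSCRSS.hess_ge` then
give ‖EP‖ ≤ 0.32‖X − M‖ + 2x/α.

Second order. B may be padded and rotated without changing BBᵀ so that WᵀB is positive semidefinite,
by a polar decomposition. Testing the Hessian on W − B yields 2α‖X − M‖² ≤ β‖(W − B)Wᵀ‖² + 2x‖E‖.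

The two are joined by the Procrustes-type bound ‖(W − B)Wᵀ‖² ≤ ‖E‖²/8 + 17‖EP‖²/4
(`norm_sub_mul_transpose_le`). The left side is at least α‖E‖²/2; for β/α ≤ 1.38 the ‖E‖² terms on
the right have total coefficient below α/2, so they are absorbed and ‖E‖ is bounded by a multiple of
x/α. -/

namespace LowRank

/-! ### Trace inner product and Gram identities -/

section FrobeniusInner

variable {I J K L : Type*} [Fintype I] [Fintype J] [Fintype K] [Fintype L]

/-- The trace inner product of real matrices. -/
noncomputable def ip (A B : Matrix I J ℝ) : ℝ := (Aᵀ * B).trace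

lemma ip_eq_sum (A B : Matrix I J ℝ) : ip A B = ∑ i, ∑ j, A i j * B i j := by
  simp only [ip, Matrix.trace, Matrix.diag_apply, Matrix.mul_apply, Matrix.transpose_apply]
  exact Finset.sum_comm

lemma ip_comm (A B : Matrix I J ℝ) : ip A B = ip B A := by
  simp only [ip_eq_sum, mul_comm]

lemma ip_add_left (A B C : Matrix I J ℝ) : ip (A + B) C = ip A C + ip B C := by
  simp [ip, Matrix.add_mul]

lemma ip_sub_left (A B C : Matrix I J ℝ) : ip (A - B) C = ip A C - ip B C := by
  simp [ip, Matrix.sub_mul]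

lemma ip_add_right (A B C : Matrix I J ℝ) : ip A (B + C) = ip A B + ip A C := by
  simp [ip, Matrix.mul_add]

lemma ip_sub_right (A B C : Matrix I J ℝ) : ip A (B - C) = ip A B - ip A C := by
  simp [ip, Matrix.mul_sub]

lemma ip_smul_left (c : ℝ) (A B : Matrix I J ℝ) : ip (c • A) B = c * ip A B := by
  simp [ip]

lemma ip_smul_right (c : ℝ) (A B : Matrix I J ℝ) : ip A (c • B) = c * ip A B := by
  simp [ip]

lemma ip_zero_left (A : Matrix I J ℝ) : ip 0 A = 0 := by simp [ip]

lemma ip_zero_right (A : Matrix I J ℝ) : ip A 0 = 0 := by simp [ip]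

lemma ip_neg_right (A B : Matrix I J ℝ) : ip A (-B) = -ip A B := by simp [ip]

lemma ip_transpose (A B : Matrix I J ℝ) : ip Aᵀ Bᵀ = ip A B := by
  simp only [ip_eq_sum, Matrix.transpose_apply]
  exact Finset.sum_comm

lemma ip_mul_left (A : Matrix I K ℝ) (B : Matrix K J ℝ) (C : Matrix I J ℝ) :
    ip (A * B) C = ip B (Aᵀ * C) := by
  simp [ip, Matrix.mul_assoc]

lemma ip_mul_right (A : Matrix I K ℝ) (B : Matrix K J ℝ) (C : Matrix I J ℝ) :
    ip (A * B) C = ip A (C * Bᵀ) := by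
  rw [← ip_transpose, Matrix.transpose_mul, ip_mul_left, ← ip_transpose A]
  simp

lemma norm_sq_eq_ip (A : Matrix I J ℝ) : ‖A‖ ^ 2 = ip A A := by
  have h : (0 : ℝ) ≤ ∑ i, ∑ j, A i j ^ 2 := by positivity
  rw [ip_eq_sum, Matrix.frobenius_norm_def]
  simp only [Real.rpow_two, Real.norm_eq_abs, sq_abs]
  rw [← Real.sqrt_eq_rpow, Real.sq_sqrt h]
  simp only [sq]

lemma ip_self_nonneg (A : Matrix I J ℝ) : 0 ≤ ip A A := by
  rw [← norm_sq_eq_ip]; positivity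

lemma abs_ip_le (A B : Matrix I J ℝ) : |ip A B| ≤ ‖A‖ * ‖B‖ := by
  refine abs_le_of_sq_le_sq ?_ (by positivity)
  rw [mul_pow, norm_sq_eq_ip, norm_sq_eq_ip]
  simp only [ip_eq_sum, ← Finset.sum_product', ← sq]
  exact Finset.sum_mul_sq_le_sq_mul_sq Finset.univ (fun p : I × J => A p.1 p.2) fun p => B p.1 p.2

/-- The Gram identity `⟨ABᵀ, CDᵀ⟩ = ⟨CᵀA, DᵀB⟩`. -/
lemma ip_mul_transpose (A : Matrix I K ℝ) (B : Matrix J K ℝ) (C : Matrix I L ℝ)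
    (D : Matrix J L ℝ) : ip (A * Bᵀ) (C * Dᵀ) = ip (Cᵀ * A) (Dᵀ * B) := by
  rw [ip_mul_right, ip_mul_left, Matrix.transpose_transpose, Matrix.transpose_transpose,
    Matrix.mul_assoc]

/-- `‖ABᵀ‖² = ⟨AᵀA, BᵀB⟩`. -/
lemma ip_mul_transpose_self (A : Matrix I K ℝ) (B : Matrix J K ℝ) :
    ip (A * Bᵀ) (A * Bᵀ) = ip (Aᵀ * A) (Bᵀ * B) := ip_mul_transpose A B A B

lemma ip_nonneg_of_posSemidef {A : Matrix I K ℝ} {S : Matrix K K ℝ} (hS : S.PosSemidef) :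
    0 ≤ ip (Aᵀ * A) S := by
  have h : ip (Aᵀ * A) S = (A * S * Aᴴ).trace := by
    rw [ip, Matrix.transpose_mul, Matrix.transpose_transpose,
      Matrix.conjTranspose_eq_transpose_of_trivial, Matrix.trace_mul_comm (A * S), Matrix.mul_assoc]
  rw [h]
  exact (hS.mul_mul_conjTranspose_same A).trace_nonneg

end FrobeniusInner

/-! ### Procrustes-type bounds for aligned factors -/

section Alignment

variable {I K : Type*} [Fintype I] [Fintype K]

/-- A weak form of the Procrustes bound for aligned factors. -/
lemma norm_sub_mul_transpose_le_of_aligned (W B : Matrix I K ℝ) (h : (Wᵀ * B).PosSemidef) :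
    4 / 5 * ‖(W - B) * Wᵀ‖ ^ 2 ≤ ‖W * Wᵀ - B * Bᵀ‖ ^ 2 := by
  obtain ⟨D, rfl⟩ : ∃ D, B = W - D := ⟨W - B, by simp⟩
  have hs := ip_nonneg_of_posSemidef (A := D) h
  have hsym : (Wᵀ * D)ᵀ = Wᵀ * D := by
    have h1 : (Wᵀ * (W - D))ᵀ = Wᵀ * (W - D) := h.isHermitian
    rw [Matrix.mul_sub, Matrix.transpose_sub] at h1
    simpa using h1
  have hsym' : Dᵀ * W = Wᵀ * D := by simpa using hsym
  have hE : W * Wᵀ - (W - D) * (W - D)ᵀ = W * Dᵀ + D * Wᵀ - D * Dᵀ := by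
    rw [Matrix.transpose_sub, Matrix.sub_mul, Matrix.mul_sub, Matrix.mul_sub]; abel
  rw [hE, norm_sq_eq_ip, norm_sq_eq_ip, sub_sub_cancel]
  -- With G = DᵀD and T = WᵀD, ‖E‖² = 2⟨G, WᵀW⟩ + 2‖T‖² + ‖G‖² − 4⟨G, T⟩, and alignment gives ⟨G,
  -- WᵀW⟩ ≥ ⟨G, T⟩. Spending 6/5 of the first term leaves ‖G − (7/5)T‖² + ‖T‖²/25.
  have hq := ip_self_nonneg (Dᵀ * D - (7 / 5 : ℝ) • (Wᵀ * D))
  have hT := ip_self_nonneg (Wᵀ * D)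
  simp only [ip_add_left, ip_sub_left, ip_add_right, ip_sub_right, ip_smul_left, ip_smul_right,
    ip_mul_transpose, Matrix.mul_sub, hsym'] at hs hq hT ⊢
  rw [ip_comm (Wᵀ * D) (Dᵀ * D)] at *
  rw [ip_comm (Wᵀ * W) (Dᵀ * D)] at *
  linarith

/-- The part of the factor error which is seen by the range projection `P` of `W`. -/
lemma norm_sub_mul_transpose_le (W B : Matrix I K ℝ) (P : Matrix I I ℝ)
    (hP : Pᵀ = P) (hPP : P * P = P) (hPW : P * W = W) (h : (Wᵀ * B).PosSemidef) :
    ‖(W - B) * Wᵀ‖ ^ 2 ≤ 1 / 8 * ‖W * Wᵀ - B * Bᵀ‖ ^ 2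
      + 17 / 4 * ‖(W * Wᵀ - B * Bᵀ) * P‖ ^ 2 := by
  -- Alignment sees only the part B₁ of B inside the range of W. The part B₂ is orthogonal to both W
  -- and B₁, so every norm below splits.
  set B₁ := P * B with hB₁
  set B₂ := B - P * B with hB₂
  have hWP : Wᵀ * P = Wᵀ := by
    rw [← hP, ← Matrix.transpose_mul, hPW]
  have hB : B = B₁ + B₂ := by simp [hB₁, hB₂]
  have hWB₁ : Wᵀ * B₁ = Wᵀ * B := by rw [hB₁, ← Matrix.mul_assoc, hWP]
  have hWB₂ : Wᵀ * B₂ = 0 := by rw [hB₂, Matrix.mul_sub, ← hB₁, hWB₁, sub_self]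
  have hPB₁ : P * B₁ = B₁ := by rw [hB₁, ← Matrix.mul_assoc, hPP]
  have hPB₂ : P * B₂ = 0 := by rw [hB₂, Matrix.mul_sub, ← hB₁, hPB₁, sub_self]
  have hB₁P : B₁ᵀ * P = B₁ᵀ := by
    rw [← hP, ← Matrix.transpose_mul, hPB₁]
  have hB₂P : B₂ᵀ * P = 0 := by
    rw [← hP, ← Matrix.transpose_mul, hPB₂, Matrix.transpose_zero]
  have h12 : B₁ᵀ * B₂ = 0 := by
    rw [← hB₁P, Matrix.mul_assoc, hPB₂, Matrix.mul_zero]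
  have h21 : B₂ᵀ * B₁ = 0 := by
    rw [← hPB₁, ← Matrix.mul_assoc, hB₂P, Matrix.zero_mul]
  have hB₂W : B₂ᵀ * W = 0 := by
    have := congrArg Matrix.transpose hWB₂
    simpa using this
  rw [← hWB₁] at h
  have hal := norm_sub_mul_transpose_le_of_aligned W B₁ h
  have hsym : B₁ᵀ * W = Wᵀ * B₁ := by
    have : (Wᵀ * B₁)ᵀ = Wᵀ * B₁ := h.isHermitian
    simpa using this
  clear_value B₁ B₂
  subst hB
  have hE : W * Wᵀ - (B₁ + B₂) * (B₁ + B₂)ᵀ =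
      (W * Wᵀ - B₁ * B₁ᵀ) - B₁ * B₂ᵀ - B₂ * B₁ᵀ - B₂ * B₂ᵀ := by
    rw [Matrix.transpose_add, Matrix.add_mul, Matrix.mul_add, Matrix.mul_add]; abel
  have hEP : (W * Wᵀ - (B₁ + B₂) * (B₁ + B₂)ᵀ) * P = (W * Wᵀ - B₁ * B₁ᵀ) - B₂ * B₁ᵀ := by
    rw [hE]
    simp only [Matrix.sub_mul, Matrix.mul_assoc, hWP, hB₁P, hB₂P, Matrix.mul_zero]
    abel
  have hD : (W - (B₁ + B₂)) * Wᵀ = (W - B₁) * Wᵀ - B₂ * Wᵀ := by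
    rw [← sub_sub, Matrix.sub_mul]
  have e0 : ‖(W - (B₁ + B₂)) * Wᵀ‖ ^ 2 = ‖(W - B₁) * Wᵀ‖ ^ 2 + ip (B₂ᵀ * B₂) (Wᵀ * W) := by
    rw [hD]
    simp only [norm_sq_eq_ip, ip_sub_left, ip_sub_right, ip_mul_transpose, Matrix.sub_mul,
      hWB₂, hB₂W, h12, h21, ip_zero_left]
    ring
  have e1 : ‖(W * Wᵀ - B₁ * B₁ᵀ) - B₂ * B₁ᵀ‖ ^ 2 =
      ‖W * Wᵀ - B₁ * B₁ᵀ‖ ^ 2 + ip (B₂ᵀ * B₂) (B₁ᵀ * B₁) := by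
    simp only [norm_sq_eq_ip, ip_sub_left, ip_sub_right, ip_mul_transpose,
      hWB₂, hB₂W, h12, h21, ip_zero_left]
    ring
  have e2 : ‖(W * Wᵀ - B₁ * B₁ᵀ) - B₁ * B₂ᵀ - B₂ * B₁ᵀ - B₂ * B₂ᵀ‖ ^ 2 =
      ‖W * Wᵀ - B₁ * B₁ᵀ‖ ^ 2 + 2 * ip (B₂ᵀ * B₂) (B₁ᵀ * B₁) + ip (B₂ᵀ * B₂) (B₂ᵀ * B₂) := by
    simp only [norm_sq_eq_ip, ip_sub_left, ip_sub_right, ip_mul_transpose,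
      hWB₂, hB₂W, h12, h21, ip_zero_left, ip_zero_right]
    rw [ip_comm (B₁ᵀ * B₁) (B₂ᵀ * B₂)]
    ring
  have hnn : 0 ≤ ip (B₂ᵀ * B₂) (B₁ᵀ * B₁) := by
    rw [← ip_mul_transpose_self]; exact ip_self_nonneg _
  -- After expansion this is ‖WᵀB₁‖² ≤ ‖WB₁ᵀ‖², which is Cauchy–Schwarz for WB₁ᵀ and its transpose
  -- because WᵀB₁ is symmetric.
  have hfl : ip (Wᵀ * W - B₁ᵀ * B₁) (Wᵀ * W - B₁ᵀ * B₁) ≤ ‖W * Wᵀ - B₁ * B₁ᵀ‖ ^ 2 := by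
    have h1 : ip (Wᵀ * B₁) (B₁ᵀ * W) = ip (Wᵀ * B₁) (Wᵀ * B₁) := by rw [hsym]
    have h2 : |ip (W * B₁ᵀ) (B₁ * Wᵀ)| ≤ ‖W * B₁ᵀ‖ * ‖B₁ * Wᵀ‖ := abs_ip_le _ _
    have h3 : ‖W * B₁ᵀ‖ = ‖B₁ * Wᵀ‖ := by
      rw [← Matrix.frobenius_norm_transpose]; simp
    rw [h3, ← sq, norm_sq_eq_ip, ip_mul_transpose, ip_mul_transpose, hsym] at h2
    simp only [norm_sq_eq_ip, ip_sub_left, ip_sub_right, ip_mul_transpose, hsym]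
    rw [ip_comm (Wᵀ * W) (B₁ᵀ * B₁)]
    linarith [le_abs_self (ip (Wᵀ * B₁) (Wᵀ * B₁))]
  -- Weighted Young inequality: ⟨B₂ᵀB₂, Δ⟩ ≤ ‖B₂ᵀB₂‖²/8 + 2‖Δ‖² with Δ = WᵀW − B₁ᵀB₁. The weight 1/8
  -- falls on the part of E that P does not see.
  have hq := ip_self_nonneg (B₂ᵀ * B₂ - (4 : ℝ) • (Wᵀ * W - B₁ᵀ * B₁))
  simp only [ip_sub_left (B₂ᵀ * B₂), ip_sub_right _ (B₂ᵀ * B₂), ip_smul_left, ip_smul_right] at hq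
  rw [ip_comm (Wᵀ * W - B₁ᵀ * B₁) (B₂ᵀ * B₂), ip_sub_right (B₂ᵀ * B₂)] at hq
  rw [e0, hEP, e1, hE, e2]
  linarith [sq_nonneg ‖W * Wᵀ - B₁ * B₁ᵀ‖]

end Alignment

/-! ### Range projections, spectral norm duality, polar decomposition -/

section Spectral

variable {I J K : Type*} [Fintype I] [Fintype J] [Fintype K]

lemma eq_zero_of_mul_transpose_self {A : Matrix I J ℝ} (h : A * Aᵀ = 0) : A = 0 := by
  rw [← norm_eq_zero, ← sq_eq_zero_iff, norm_sq_eq_ip, ip, Matrix.trace_mul_comm, h,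
    Matrix.trace_zero]

/-- The matrix of the orthogonal projection onto the column space. -/
lemma exists_range_projection [DecidableEq I] (W : Matrix I K ℝ) :
    ∃ (P : Matrix I I ℝ) (C : Matrix K I ℝ),
      Pᵀ = P ∧ P * P = P ∧ P * W = W ∧ P = W * C ∧ ‖P‖ ^ 2 = W.rank := by
  have hG : (W * Wᵀ).IsHermitian := by
    simpa using Matrix.isHermitian_mul_conjTranspose_self W
  set O : Matrix I I ℝ := (hG.eigenvectorUnitary : Matrix I I ℝ) with hO
  have hOO : Oᵀ * O = 1 := Unitary.coe_star_mul_self hG.eigenvectorUnitary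
  have hOO' : O * Oᵀ = 1 := Unitary.coe_mul_star_self hG.eigenvectorUnitary
  have hspec : W * Wᵀ = O * Matrix.diagonal hG.eigenvalues * Oᵀ := by
    have := hG.spectral_theorem
    rw [Unitary.conjStarAlgAut_apply] at this
    exact this
  set d := hG.eigenvalues
  have key : ∀ a b : I → ℝ, (O * Matrix.diagonal a * Oᵀ) * (O * Matrix.diagonal b * Oᵀ) =
      O * Matrix.diagonal (fun i => a i * b i) * Oᵀ := by
    intro a b
    rw [← Matrix.diagonal_mul_diagonal]
    calc _ = O * Matrix.diagonal a * (Oᵀ * O) * Matrix.diagonal b * Oᵀ := by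
          simp only [Matrix.mul_assoc]
      _ = _ := by rw [hOO]; simp only [Matrix.mul_assoc, Matrix.one_mul]
  set p : I → ℝ := fun i => if d i = 0 then 0 else 1 with hp
  have hPG : (O * Matrix.diagonal p * Oᵀ) * (W * Wᵀ) = W * Wᵀ := by
    rw [hspec, key]
    congr 3
    funext i
    by_cases h : d i = 0 <;> simp [hp, h]
  have hT : (O * Matrix.diagonal p * Oᵀ)ᵀ = O * Matrix.diagonal p * Oᵀ := by
    simp [Matrix.mul_assoc]
  have hI : (O * Matrix.diagonal p * Oᵀ) * (O * Matrix.diagonal p * Oᵀ) =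
      O * Matrix.diagonal p * Oᵀ := by
    rw [key]
    congr 3
    funext i
    by_cases h : d i = 0 <;> simp [hp, h]
  -- The second witness is Wᵀ times the pseudo-inverse of WWᵀ; the convention 0⁻¹ = 0 handles the
  -- kernel.
  refine ⟨O * Matrix.diagonal p * Oᵀ, Wᵀ * (O * Matrix.diagonal (fun i => (d i)⁻¹) * Oᵀ),
    hT, hI, ?_, ?_, ?_⟩
  · have h0 : ((1 - O * Matrix.diagonal p * Oᵀ) * W) *
        ((1 - O * Matrix.diagonal p * Oᵀ) * W)ᵀ = 0 := by
      rw [Matrix.transpose_mul, ← Matrix.mul_assoc, Matrix.mul_assoc _ W, Matrix.sub_mul, hPG,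
        Matrix.one_mul, sub_self, Matrix.zero_mul]
    have h1 := eq_zero_of_mul_transpose_self h0
    rw [Matrix.sub_mul, Matrix.one_mul, sub_eq_zero] at h1
    exact h1.symm
  · rw [← Matrix.mul_assoc W, hspec, key]
    congr 3
    funext i
    by_cases h : d i = 0 <;> simp [hp, h]
  · have hr : W.rank = Fintype.card {i // d i ≠ 0} := by
      rw [← hG.rank_eq_card_non_zero_eigs, Matrix.rank_self_mul_transpose]
    rw [norm_sq_eq_ip, ip, hT, hI, Matrix.trace_mul_comm, ← Matrix.mul_assoc, hOO,
      Matrix.one_mul, Matrix.trace_diagonal, hr, Fintype.card_subtype, Finset.card_filter]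
    push_cast
    refine Finset.sum_congr rfl fun i _ => ?_
    by_cases h : d i = 0 <;> simp [hp, h]

lemma mulVec_dotProduct_self_le [DecidableEq I] [DecidableEq J] (A : Matrix I J ℝ) (x : J → ℝ) :
    A *ᵥ x ⬝ᵥ A *ᵥ x ≤ specNorm A ^ 2 * (x ⬝ᵥ x) := by
  have h := (LinearMap.toContinuousLinearMap (Matrix.toEuclideanLin A)).le_opNorm
    (WithLp.toLp 2 x)
  have h2 := pow_le_pow_left₀ (norm_nonneg _) h 2
  rw [mul_pow, EuclideanSpace.norm_sq_eq, EuclideanSpace.norm_sq_eq] at h2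
  simpa [specNorm, dotProduct, ← sq, Matrix.toLpLin_apply] using h2

lemma specNorm_nonneg [DecidableEq I] [DecidableEq J] (A : Matrix I J ℝ) : 0 ≤ specNorm A :=
  norm_nonneg _

lemma specNorm_sq_le [DecidableEq I] [DecidableEq J] (A : Matrix I J ℝ) {c : ℝ} (hc : 0 ≤ c)
    (h : ∀ x : J → ℝ, A *ᵥ x ⬝ᵥ A *ᵥ x ≤ c * (x ⬝ᵥ x)) : specNorm A ^ 2 ≤ c := by
  rw [← Real.sq_sqrt hc]
  refine pow_le_pow_left₀ (norm_nonneg _) ?_ 2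
  refine ContinuousLinearMap.opNorm_le_bound _ (Real.sqrt_nonneg _) fun x => ?_
  refine le_of_sq_le_sq ?_ (by positivity)
  rw [mul_pow, Real.sq_sqrt hc, EuclideanSpace.norm_sq_eq, EuclideanSpace.norm_sq_eq]
  simpa [dotProduct, ← sq, Matrix.toLpLin_apply] using h x.ofLp

lemma specNorm_transpose [DecidableEq I] [DecidableEq J] (A : Matrix I J ℝ) :
    specNorm Aᵀ = specNorm A := by
  have := Matrix.l2_opNorm_conjTranspose A
  rw [Matrix.conjTranspose_eq_transpose_of_trivial] at this
  exact this

lemma norm_mul_le_specNorm [DecidableEq I] [DecidableEq J] (A : Matrix I J ℝ)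
    (C : Matrix J K ℝ) : ‖A * C‖ ≤ specNorm A * ‖C‖ := by
  refine le_of_sq_le_sq ?_ (mul_nonneg (specNorm_nonneg A) (norm_nonneg _))
  rw [mul_pow, ← Matrix.frobenius_norm_transpose, ← Matrix.frobenius_norm_transpose C,
    norm_sq_eq_ip, norm_sq_eq_ip, ip_eq_sum, ip_eq_sum, Finset.mul_sum]
  exact Finset.sum_le_sum fun k _ => mulVec_dotProduct_self_le A fun j => C j k

/-- Duality of the spectral norm with the Frobenius norm on low rank matrices. -/
lemma abs_ip_le_specNorm [DecidableEq I] [DecidableEq J] (A B : Matrix I J ℝ) {k : ℕ}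
    (hk : B.rank ≤ k) : |ip A B| ≤ √k * specNorm A * ‖B‖ := by
  obtain ⟨P, -, hPT, -, hPW, -, hP⟩ := exists_range_projection Bᵀ
  have hB : B * P = B := by
    have := congrArg Matrix.transpose hPW
    simpa [hPT] using this
  -- P projects onto the row space of B, so A may be cut down to AP, whose Frobenius norm is at most
  -- the spectral norm of A times ‖P‖ = √rank B.
  have h1 : ip A B = ip (A * P) B := by
    rw [ip_mul_right, hPT, hB]
  have h2 : ‖P‖ ≤ √k := by
    refine Real.le_sqrt_of_sq_le ?_
    rw [hP, Matrix.rank_transpose]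
    exact_mod_cast hk
  calc |ip A B| = |ip (A * P) B| := by rw [h1]
    _ ≤ ‖A * P‖ * ‖B‖ := abs_ip_le _ _
    _ ≤ (specNorm A * ‖P‖) * ‖B‖ := by gcongr; exact norm_mul_le_specNorm A P
    _ ≤ (specNorm A * √k) * ‖B‖ := by gcongr; exact specNorm_nonneg A
    _ = _ := by ring

/-- A polar decomposition: every square matrix becomes positive semidefinite after multiplication
by an orthogonal one. -/
lemma exists_orthogonal_mul_posSemidef [DecidableEq K] (A : Matrix K K ℝ) :
    ∃ R ∈ Matrix.orthogonalGroup K ℝ, (A * R).PosSemidef := by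
  have hpsd : (A * Aᵀ).PosSemidef := by
    simpa using Matrix.posSemidef_self_mul_conjTranspose A
  have hG := hpsd.isHermitian
  set O : Matrix K K ℝ := (hG.eigenvectorUnitary : Matrix K K ℝ) with hO
  have hOO : Oᵀ * O = 1 := Unitary.coe_star_mul_self hG.eigenvectorUnitary
  have hspec : A * Aᵀ = O * Matrix.diagonal hG.eigenvalues * Oᵀ := by
    have := hG.spectral_theorem
    rw [Unitary.conjStarAlgAut_apply] at this
    exact this
  have hd : ∀ i, 0 ≤ hG.eigenvalues i := hpsd.eigenvalues_nonneg
  set N := O * Matrix.diagonal (fun i => √(hG.eigenvalues i)) * Oᵀ with hN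
  have hNpsd : N.PosSemidef := by
    have := (Matrix.PosSemidef.diagonal (R := ℝ) (d := fun i => √(hG.eigenvalues i))
      fun i => Real.sqrt_nonneg _).mul_mul_conjTranspose_same O
    simpa [hN] using this
  have hNT : Nᵀ = N := hNpsd.isHermitian
  have hNN : N * N = A * Aᵀ := by
    calc N * N = O * Matrix.diagonal (fun i => √(hG.eigenvalues i)) * (Oᵀ * O) *
          Matrix.diagonal (fun i => √(hG.eigenvalues i)) * Oᵀ := by
          simp only [hN, Matrix.mul_assoc]
      _ = O * (Matrix.diagonal (fun i => √(hG.eigenvalues i)) *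
          Matrix.diagonal (fun i => √(hG.eigenvalues i))) * Oᵀ := by
          rw [hOO, Matrix.mul_one]; simp only [Matrix.mul_assoc]
      _ = A * Aᵀ := by
          simp only [Matrix.diagonal_mul_diagonal, Real.mul_self_sqrt (hd _)]
          exact hspec.symm
  -- Since N² = AAᵀ, the map Nx ↦ Aᵀx is a well-defined isometry on the range of N. Any isometric
  -- extension Q to the whole space satisfies QN = Aᵀ, whence AQ = N.
  have hnorm : ∀ x, ‖Matrix.toEuclideanLin Aᵀ x‖ = ‖Matrix.toEuclideanLin N x‖ := by
    intro x
    rw [← sq_eq_sq₀ (norm_nonneg _) (norm_nonneg _), EuclideanSpace.norm_sq_eq,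
      EuclideanSpace.norm_sq_eq]
    have h1 : Aᵀ *ᵥ x.ofLp ⬝ᵥ Aᵀ *ᵥ x.ofLp = N *ᵥ x.ofLp ⬝ᵥ N *ᵥ x.ofLp := by
      rw [Matrix.dotProduct_mulVec, ← Matrix.mulVec_transpose, Matrix.mulVec_mulVec,
        Matrix.dotProduct_mulVec (N *ᵥ x.ofLp), ← Matrix.mulVec_transpose, Matrix.mulVec_mulVec,
        hNT, hNN, Matrix.transpose_transpose]
    simpa [dotProduct, ← sq, Matrix.toLpLin_apply] using h1
  set F := Matrix.toEuclideanLin N with hF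
  set G := Matrix.toEuclideanLin Aᵀ with hGdef
  have hker : LinearMap.ker F ≤ LinearMap.ker G := by
    intro x hx
    rw [LinearMap.mem_ker] at hx ⊢
    rw [← norm_eq_zero, hnorm, hx, norm_zero]
  have hfac : ∀ x, ((LinearMap.ker F).liftQ G hker ∘ₗ
      F.quotKerEquivRange.symm.toLinearMap) ⟨F x, LinearMap.mem_range_self F x⟩ = G x := by
    intro x
    simp [LinearMap.quotKerEquivRange_symm_apply_image]
  let T₀ : LinearMap.range F →ₗᵢ[ℝ] EuclideanSpace ℝ K :=
    { toLinearMap := (LinearMap.ker F).liftQ G hker ∘ₗ F.quotKerEquivRange.symm.toLinearMap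
      norm_map' := by
        rintro ⟨_, x, rfl⟩
        rw [hfac, hnorm]
        rfl }
  let T := T₀.extend
  have hT : ∀ x, T (F x) = G x := fun x => by
    rw [← hfac x]
    exact T₀.extend_apply ⟨F x, LinearMap.mem_range_self F x⟩
  set Q : Matrix K K ℝ := Matrix.toEuclideanLin.symm T.toLinearMap with hQ
  have hQT : Matrix.toEuclideanLin Q = T.toLinearMap := by simp [hQ]
  have hQN : Q * N = Aᵀ := by
    apply Matrix.toEuclideanLin.injective
    refine LinearMap.ext fun x => ?_
    rw [← hGdef, ← hT x, ← T.coe_toLinearMap, ← hQT, hF]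
    simp [Matrix.toLpLin_apply]
  have hQQ : Qᵀ * Q = 1 := by
    ext i j
    have h1 := T.inner_map_map (EuclideanSpace.single i 1) (EuclideanSpace.single j 1)
    rw [← T.coe_toLinearMap, ← hQT] at h1
    have h2 : ∑ k, Q k j * Q k i = if i = j then 1 else 0 := by
      simpa [Matrix.toLpLin_apply, PiLp.inner_apply] using h1
    rw [Matrix.mul_apply, Matrix.one_apply, ← h2]
    exact Finset.sum_congr rfl fun k _ => mul_comm _ _
  refine ⟨Q, (Matrix.mem_orthogonalGroup_iff' K ℝ).2 hQQ, ?_⟩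
  have hA : A = N * Qᵀ := by
    rw [← hNT, ← Matrix.transpose_mul, hQN, Matrix.transpose_transpose]
  rw [hA, Matrix.mul_assoc, hQQ, Matrix.mul_one]
  exact hNpsd

end Spectral

/-! ### Rank bounds -/

section Rank

variable {I J K : Type*} [Fintype J]

lemma rank_add_le (A B : Matrix I J ℝ) : (A + B).rank ≤ A.rank + B.rank := by
  have h : LinearMap.range (A + B).mulVecLin ≤
      LinearMap.range A.mulVecLin ⊔ LinearMap.range B.mulVecLin := by
    rintro _ ⟨x, rfl⟩
    rw [Matrix.mulVecLin_apply, Matrix.add_mulVec]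
    exact Submodule.add_mem_sup ⟨x, rfl⟩ ⟨x, rfl⟩
  exact (Submodule.finrank_mono h).trans (Submodule.finrank_add_le_finrank_add_finrank _ _)

lemma rank_neg (A : Matrix I J ℝ) : (-A).rank = A.rank := by
  classical
  refine le_antisymm ?_ ?_
  · simpa using Matrix.rank_mul_le_left A (-1 : Matrix J J ℝ)
  · simpa using Matrix.rank_mul_le_left (-A) (-1 : Matrix J J ℝ)

lemma rank_sub_le (A B : Matrix I J ℝ) : (A - B).rank ≤ A.rank + B.rank := by
  rw [sub_eq_add_neg, ← rank_neg B]; exact rank_add_le _ _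

lemma rank_smul_le (c : ℝ) (A : Matrix I J ℝ) : (c • A).rank ≤ A.rank := by
  classical
  have := Matrix.rank_mul_le_left A (c • (1 : Matrix J J ℝ))
  rwa [Matrix.mul_smul, Matrix.mul_one] at this

variable [Fintype I] [Fintype K]

/-- For balanced factors the rank of each factor is bounded by the rank of the product. -/
lemma rank_left_le_of_balanced {U : Matrix I K ℝ} {V : Matrix J K ℝ} (hb : Uᵀ * U = Vᵀ * V) :
    U.rank ≤ (U * Vᵀ).rank := by
  -- Balance exhibits UVᵀ as a factor of (UᵀU)², which has the same rank as U.
  have h1 : (Uᵀ * U)ᵀ * (Uᵀ * U) = Uᵀ * ((U * Vᵀ) * V) := by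
    rw [Matrix.transpose_mul, Matrix.transpose_transpose]
    nth_rewrite 2 [hb]
    simp only [Matrix.mul_assoc]
  rw [← Matrix.rank_transpose_mul_self U, ← Matrix.rank_transpose_mul_self (Uᵀ * U), h1]
  exact (Matrix.rank_mul_le_right _ _).trans (Matrix.rank_mul_le_left _ _)

lemma rank_right_le_of_balanced {U : Matrix I K ℝ} {V : Matrix J K ℝ} (hb : Uᵀ * U = Vᵀ * V) :
    V.rank ≤ (U * Vᵀ).rank := by
  rw [← Matrix.rank_transpose_mul_self V, ← hb, Matrix.rank_transpose_mul_self]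
  exact rank_left_le_of_balanced hb

lemma rank_fromRows_le_of_balanced {U : Matrix I K ℝ} {V : Matrix J K ℝ}
    (hb : Uᵀ * U = Vᵀ * V) : (Matrix.fromRows U V).rank ≤ (U * Vᵀ).rank := by
  rw [← Matrix.rank_transpose_mul_self, Matrix.transpose_fromRows, Matrix.fromCols_mul_fromRows,
    ← hb, ← two_smul ℝ]
  refine (rank_smul_le _ _).trans ?_
  rw [Matrix.rank_transpose_mul_self]
  exact rank_left_le_of_balanced hb

end Rank

/-! ### Stacked factors and block matrices -/

section Blocks

variable {I J K L : Type*} [Fintype I] [Fintype J] [Fintype K] [Fintype L]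

lemma ip_fromBlocks (A A' : Matrix I K ℝ) (B B' : Matrix I L ℝ) (C C' : Matrix J K ℝ)
    (D D' : Matrix J L ℝ) :
    ip (Matrix.fromBlocks A B C D) (Matrix.fromBlocks A' B' C' D') =
      ip A A' + ip B B' + ip C C' + ip D D' := by
  simp only [ip_eq_sum, Fintype.sum_sum_type, Matrix.fromBlocks_apply₁₁, Matrix.fromBlocks_apply₁₂,
    Matrix.fromBlocks_apply₂₁, Matrix.fromBlocks_apply₂₂, Finset.sum_add_distrib]
  ring

lemma fromRows_mul_transpose {I J K : Type*} [Fintype K] (A : Matrix I K ℝ) (B : Matrix J K ℝ)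
    (C : Matrix I K ℝ) (D : Matrix J K ℝ) : Matrix.fromRows A B * (Matrix.fromRows C D)ᵀ =
      Matrix.fromBlocks (A * Cᵀ) (A * Dᵀ) (B * Cᵀ) (B * Dᵀ) := by
  rw [Matrix.transpose_fromRows, Matrix.fromRows_mul_fromCols]

lemma norm_sq_gram_sub (U : Matrix I K ℝ) (V : Matrix J K ℝ) (U' : Matrix I L ℝ)
    (V' : Matrix J L ℝ) :
    ‖Matrix.fromRows U V * (Matrix.fromRows U V)ᵀ
        - Matrix.fromRows U' V' * (Matrix.fromRows U' V')ᵀ‖ ^ 2 =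
      ‖U * Uᵀ - U' * U'ᵀ‖ ^ 2 + ‖V * Vᵀ - V' * V'ᵀ‖ ^ 2 + 2 * ‖U * Vᵀ - U' * V'ᵀ‖ ^ 2 := by
  have h : V * Uᵀ - V' * U'ᵀ = (U * Vᵀ - U' * V'ᵀ)ᵀ := by simp
  rw [norm_sq_eq_ip, fromRows_mul_transpose, fromRows_mul_transpose, sub_eq_add_neg,
    Matrix.fromBlocks_neg, Matrix.fromBlocks_add, ip_fromBlocks]
  simp only [← sub_eq_add_neg]
  rw [h, ip_transpose]
  simp only [norm_sq_eq_ip]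
  ring

lemma two_mul_norm_sq_sub_le (U : Matrix I K ℝ) (V : Matrix J K ℝ) (U' : Matrix I L ℝ)
    (V' : Matrix J L ℝ) :
    2 * ‖U * Vᵀ - U' * V'ᵀ‖ ^ 2 ≤ ‖Matrix.fromRows U V * (Matrix.fromRows U V)ᵀ
        - Matrix.fromRows U' V' * (Matrix.fromRows U' V')ᵀ‖ ^ 2 := by
  rw [norm_sq_gram_sub]
  nlinarith [sq_nonneg ‖U * Uᵀ - U' * U'ᵀ‖, sq_nonneg ‖V * Vᵀ - V' * V'ᵀ‖]

/-- By balance the quartic terms of the diagonal and off-diagonal errors agree, and the excess of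
the latter over the former is twice ‖U'ᵀU − V'ᵀV‖². -/
lemma norm_sq_gram_sub_le (U : Matrix I K ℝ) (V : Matrix J K ℝ) (U' : Matrix I L ℝ)
    (V' : Matrix J L ℝ) (hb : Uᵀ * U = Vᵀ * V) (hb' : U'ᵀ * U' = V'ᵀ * V') :
    ‖Matrix.fromRows U V * (Matrix.fromRows U V)ᵀ
        - Matrix.fromRows U' V' * (Matrix.fromRows U' V')ᵀ‖ ^ 2 ≤
      4 * ‖U * Vᵀ - U' * V'ᵀ‖ ^ 2 := by
  rw [norm_sq_gram_sub]
  have h := ip_self_nonneg (U'ᵀ * U - V'ᵀ * V)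
  have c1 := ip_comm (U' * U'ᵀ) (U * Uᵀ)
  have c2 := ip_comm (V' * V'ᵀ) (V * Vᵀ)
  have c3 := ip_comm (U' * V'ᵀ) (U * Vᵀ)
  have c4 := ip_comm (V'ᵀ * V) (U'ᵀ * U)
  simp only [norm_sq_eq_ip, ip_sub_left, ip_sub_right] at h ⊢
  rw [c1, c2, c3]
  simp only [ip_mul_transpose, ← hb, ← hb']
  linarith

/-- Balance gives ‖YUᵀ‖ = ‖YVᵀ‖ and ‖ZVᵀ‖ = ‖ZUᵀ‖, so the right side is 2‖YVᵀ‖² + 2‖UZᵀ‖². -/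
lemma norm_add_sq_le_of_balanced (U : Matrix I K ℝ) (V : Matrix J K ℝ) (Y : Matrix I K ℝ)
    (Z : Matrix J K ℝ) (hb : Uᵀ * U = Vᵀ * V) :
    ‖Y * Vᵀ + U * Zᵀ‖ ^ 2 ≤ ‖Matrix.fromRows Y Z * (Matrix.fromRows U V)ᵀ‖ ^ 2 := by
  have h := ip_self_nonneg (Y * Vᵀ - U * Zᵀ)
  have e1 : ip (Y * Uᵀ) (Y * Uᵀ) = ip (Y * Vᵀ) (Y * Vᵀ) := by
    rw [ip_mul_transpose_self, ip_mul_transpose_self, hb]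
  have e2 : ip (Z * Vᵀ) (Z * Vᵀ) = ip (U * Zᵀ) (U * Zᵀ) := by
    rw [ip_mul_transpose_self, ip_mul_transpose_self, hb, ip_comm]
  have e3 : ip (Z * Uᵀ) (Z * Uᵀ) = ip (U * Zᵀ) (U * Zᵀ) := by
    rw [ip_mul_transpose_self, ip_mul_transpose_self, ip_comm]
  rw [fromRows_mul_transpose, norm_sq_eq_ip, norm_sq_eq_ip, ip_fromBlocks, e1, e2, e3]
  simp only [ip_add_left, ip_add_right, ip_sub_left, ip_sub_right] at h ⊢
  linarith

/-- The off-diagonal blocks carry at least half of the correlation of the Gram error `E` with its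
projection `E * P`. -/
lemma norm_sq_mul_projection_le (U : Matrix I K ℝ) (V : Matrix J K ℝ) (U' : Matrix I L ℝ)
    (V' : Matrix J L ℝ) (Y : Matrix I K ℝ) (Z : Matrix J K ℝ)
    (hb : Uᵀ * U = Vᵀ * V) (hb' : U'ᵀ * U' = V'ᵀ * V')
    {P : Matrix (I ⊕ J) (I ⊕ J) ℝ} {C : Matrix K (I ⊕ J) ℝ} (hPT : Pᵀ = P) (hPP : P * P = P)
    (hPW : P * Matrix.fromRows U V = Matrix.fromRows U V) (hPC : P = Matrix.fromRows U V * C)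
    (hZ : Matrix.fromRows Y Z * (Matrix.fromRows U V)ᵀ =
      (Matrix.fromRows U V * (Matrix.fromRows U V)ᵀ
        - Matrix.fromRows U' V' * (Matrix.fromRows U' V')ᵀ) * P) :
    ‖(Matrix.fromRows U V * (Matrix.fromRows U V)ᵀ
        - Matrix.fromRows U' V' * (Matrix.fromRows U' V')ᵀ) * P‖ ^ 2 ≤
      2 * ip (U * Vᵀ - U' * V'ᵀ) (Y * Vᵀ + U * Zᵀ) := by
  set W := Matrix.fromRows U V with hW
  set B := Matrix.fromRows U' V' with hB
  -- Flipping the sign of the lower block and subtracting the resulting Gram error isolates twice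
  -- the off-diagonal blocks of E. Balance makes W ⊥ Wh and B ⊥ Bh, so the flipped error pairs with
  -- EP to −‖WᵀBh‖² ≤ 0.
  set Wh := Matrix.fromRows U (-V) with hWh
  set Bh := Matrix.fromRows U' (-V') with hBh
  have hWW : Whᵀ * W = 0 := by
    rw [hWh, hW, Matrix.transpose_fromRows, Matrix.fromCols_mul_fromRows, hb]; simp
  have hBB : Bhᵀ * B = 0 := by
    rw [hBh, hB, Matrix.transpose_fromRows, Matrix.fromCols_mul_fromRows, hb']; simp
  have hWP : Wᵀ * P = Wᵀ := by rw [← hPT, ← Matrix.transpose_mul, hPW]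
  have hoff : 2 * ip (U * Vᵀ - U' * V'ᵀ) (Y * Vᵀ + U * Zᵀ) =
      ip ((W * Wᵀ - B * Bᵀ) - (Wh * Whᵀ - Bh * Bhᵀ)) (Matrix.fromRows Y Z * Wᵀ) := by
    have h : V * Uᵀ - V' * U'ᵀ = (U * Vᵀ - U' * V'ᵀ)ᵀ := by simp
    have h2 : Z * Uᵀ = (U * Zᵀ)ᵀ := by simp
    have hd : (W * Wᵀ - B * Bᵀ) - (Wh * Whᵀ - Bh * Bhᵀ) =
        Matrix.fromBlocks 0 ((2 : ℝ) • (U * Vᵀ - U' * V'ᵀ))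
          ((2 : ℝ) • (V * Uᵀ - V' * U'ᵀ)) 0 := by
      simp only [hW, hB, hWh, hBh, fromRows_mul_transpose, sub_eq_add_neg, Matrix.fromBlocks_neg,
        Matrix.fromBlocks_add]
      congr 1
      · simp
      · simp [two_smul]; abel
      · simp [two_smul]; abel
      · simp
    rw [hd, hW, fromRows_mul_transpose, ip_fromBlocks, h, h2, ip_smul_left, ip_smul_left,
      ip_transpose, ip_add_right, ip_zero_left, ip_zero_left]
    ring
  have hfirst : ip (W * Wᵀ - B * Bᵀ) ((W * Wᵀ - B * Bᵀ) * P) =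
      ‖(W * Wᵀ - B * Bᵀ) * P‖ ^ 2 := by
    rw [norm_sq_eq_ip, ip_mul_right _ P, hPT, Matrix.mul_assoc, hPP]
  have hW0 : ip (Wh * Whᵀ) ((W * Wᵀ - B * Bᵀ) * P) = 0 := by
    rw [ip_comm, ip_mul_right, hPT, Matrix.mul_assoc, hPC, ← Matrix.mul_assoc Whᵀ, hWW,
      Matrix.zero_mul, Matrix.mul_zero, ip_zero_right]
  have hB0 : ip (Bh * Bhᵀ) ((W * Wᵀ - B * Bᵀ) * P) = ip (Wᵀ * Bh) (Wᵀ * Bh) := by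
    rw [Matrix.sub_mul, ip_sub_right, Matrix.mul_assoc W, hWP, ip_mul_transpose,
      Matrix.mul_assoc B, ip_mul_left _ _ (B * (Bᵀ * P)), ← Matrix.mul_assoc Bhᵀ, hBB,
      Matrix.zero_mul, ip_zero_right, sub_zero]
  have hnn := ip_self_nonneg (Wᵀ * Bh)
  rw [hoff, hZ, ip_sub_left, ip_sub_left (Wh * Whᵀ), hfirst, hW0, hB0]
  linarith

lemma smul_add_dotProduct_self_le (c : ℝ) (a b : I → ℝ) :
    (c • a + b) ⬝ᵥ (c • a + b) ≤ 2 * c ^ 2 * (a ⬝ᵥ a) + 2 * (b ⬝ᵥ b) := by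
  simp only [dotProduct, Finset.mul_sum, ← Finset.sum_add_distrib]
  refine Finset.sum_le_sum fun i _ => ?_
  simp only [Pi.add_apply, Pi.smul_apply, smul_eq_mul]
  nlinarith [sq_nonneg (c * a i - b i)]

variable [DecidableEq I] [DecidableEq J]

/-- This turns derivatives of the regularized objective into pairings with Ξ, to which spectral norm
duality applies. -/
lemma ip_xi_block (lam : ℝ) (G : Matrix I J ℝ) (U : Matrix I K ℝ) (V : Matrix J K ℝ)
    (Y : Matrix I K ℝ) (Z : Matrix J K ℝ) :
    ip (Matrix.fromBlocks (lam • 1) G Gᵀ (lam • 1))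
      (Matrix.fromRows Y Z * (Matrix.fromRows U V)ᵀ) =
      lam * (ip U Y + ip V Z) + ip G (Y * Vᵀ + U * Zᵀ) := by
  have h2 : Z * Uᵀ = (U * Zᵀ)ᵀ := by simp
  rw [fromRows_mul_transpose, ip_fromBlocks, h2, ip_transpose, ip_smul_left, ip_smul_left,
    ip_add_right, ip_comm U, ip_comm V]
  simp only [ip, Matrix.transpose_one, Matrix.one_mul]
  rw [Matrix.trace_mul_comm Y, Matrix.trace_mul_comm Z, ← Matrix.trace_transpose (Uᵀ * Y),
    ← Matrix.trace_transpose (Vᵀ * Z)]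
  simp only [Matrix.transpose_mul, Matrix.transpose_transpose]
  ring

lemma specNorm_xi_block_sq_le (lam : ℝ) (G : Matrix I J ℝ) :
    specNorm (Matrix.fromBlocks (lam • 1) G Gᵀ (lam • 1)) ^ 2 ≤
      2 * (lam ^ 2 + specNorm G ^ 2) := by
  refine specNorm_sq_le _ (by positivity) fun x => ?_
  obtain ⟨y, z, rfl⟩ : ∃ (y : I → ℝ) (z : J → ℝ), x = Sum.elim y z :=
    ⟨x ∘ Sum.inl, x ∘ Sum.inr, (Sum.elim_comp_inl_inr x).symm⟩
  have h1 := mulVec_dotProduct_self_le G z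
  have h2 := mulVec_dotProduct_self_le Gᵀ y
  rw [specNorm_transpose] at h2
  have h3 := smul_add_dotProduct_self_le lam y (G *ᵥ z)
  have h4 := smul_add_dotProduct_self_le lam z (Gᵀ *ᵥ y)
  rw [Matrix.fromBlocks_mulVec]
  simp only [Sum.elim_comp_inl, Sum.elim_comp_inr, Matrix.smul_mulVec, Matrix.one_mulVec,
    sumElim_dotProduct_sumElim]
  rw [add_comm (Gᵀ *ᵥ y)]
  linarith

end Blocks

/-! ### Derivatives, restricted Hessian bounds, and the objective Φ -/

section Calculus

/-- Mean value form of the increment of the derivative. -/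
lemma exists_hess_eq_firstDeriv_sub {E : Type*} [NormedAddCommGroup E] [NormedSpace ℝ E]
    {f : E → ℝ} (hf : ContDiff ℝ 2 f) (x d h : E) :
    ∃ t : ℝ, firstDeriv f (x + d) h - firstDeriv f x h = hess f (x + t • d) d h := by
  have hdiff : Differentiable ℝ (fderiv ℝ f) :=
    (hf.fderiv_right (m := 1) (by norm_num)).differentiable (by norm_num)
  have hline : ∀ t : ℝ, HasDerivAt (fun t : ℝ => x + t • d) d t := fun t => by
    simpa using ((hasDerivAt_id t).smul_const d).const_add x
  have hd : ∀ t : ℝ, HasDerivAt (fun t : ℝ => firstDeriv f (x + t • d) h)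
      (hess f (x + t • d) d h) t := by
    intro t
    have h1 := (hdiff (x + t • d)).hasFDerivAt.comp_hasDerivAt t (hline t)
    exact ((ContinuousLinearMap.apply ℝ ℝ h).hasFDerivAt.comp_hasDerivAt t h1 :)
  obtain ⟨c, -, hc⟩ := exists_hasDerivAt_eq_slope (fun t : ℝ => firstDeriv f (x + t • d) h)
    (fun t => hess f (x + t • d) d h) zero_lt_one
    (fun t _ => (hd t).continuousAt.continuousWithinAt) fun t _ => hd t
  -- The location of c in (0, 1) is dropped: the restricted conditions only need the rank of a point
  -- on the line through X and M.
  exact ⟨c, by simpa using hc.symm⟩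

lemma hess_comm {E : Type*} [NormedAddCommGroup E] [NormedSpace ℝ E] {f : E → ℝ}
    (hf : ContDiff ℝ 2 f) (x h k : E) : hess f x h k = hess f x k h :=
  (hf.contDiffAt.isSymmSndFDerivAt (by simp)) h k

lemma hess_polarization {E : Type*} [NormedAddCommGroup E] [NormedSpace ℝ E] {f : E → ℝ}
    (hf : ContDiff ℝ 2 f) (x h k : E) (a b : ℝ) :
    hess f x (a • h + b • k) (a • h + b • k) - hess f x (a • h - b • k) (a • h - b • k) =
      4 * a * b * hess f x h k := by
  have hs : fderiv ℝ (fderiv ℝ f) x h k = fderiv ℝ (fderiv ℝ f) x k h := hess_comm hf x h k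
  simp only [hess, map_add, map_sub, map_smul, add_apply,
    sub_apply, smul_apply, smul_eq_mul, hs]
  ring

section Bilinear

variable {A B C : Type*} [NormedAddCommGroup A] [NormedSpace ℝ A] [NormedAddCommGroup B]
  [NormedSpace ℝ B] [NormedAddCommGroup C] [NormedSpace ℝ C] {q : A → B → C} {s : A → A → ℝ}
  {t : B → B → ℝ}

lemma firstDeriv_comp_bilinear_add_sq (hq : IsBoundedBilinearMap ℝ fun p : A × B => q p.1 p.2)
    (hs : IsBoundedBilinearMap ℝ fun p : A × A => s p.1 p.2)
    (ht : IsBoundedBilinearMap ℝ fun p : B × B => t p.1 p.2) {f : C → ℝ}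
    (hf : Differentiable ℝ f) (hss : ∀ a b, s a b = s b a) (hts : ∀ a b, t a b = t b a) {c : ℝ}
    (p h : A × B) :
    firstDeriv (fun p : A × B => f (q p.1 p.2) + c * (s p.1 p.1 + t p.2 p.2)) p h =
      firstDeriv f (q p.1 p.2) (q p.1 h.2 + q h.1 p.2) + 2 * c * (s p.1 h.1 + t p.2 h.2) := by
  have h1 := (hf (q p.1 p.2)).hasFDerivAt.comp p (hq.hasFDerivAt p)
  have h2 := (hs.hasFDerivAt (p.1, p.1)).comp p
    ((hasFDerivAt_fst (𝕜 := ℝ) (p := p)).prodMk hasFDerivAt_fst)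
  have h3 := (ht.hasFDerivAt (p.2, p.2)).comp p
    ((hasFDerivAt_snd (𝕜 := ℝ) (p := p)).prodMk hasFDerivAt_snd)
  have h4 := h1.add ((h2.add h3).const_mul c)
  refine (DFunLike.congr_fun h4.fderiv h).trans ?_
  simp [firstDeriv, hss h.1 p.1, hts h.2 p.2]
  ring

/-- Differentiate the first-derivative formula along h; both bilinear terms contribute q(h₁, h₂),
hence the factor 2. -/
lemma hess_of_firstDeriv_eq (hq : IsBoundedBilinearMap ℝ fun p : A × B => q p.1 p.2)
    (hs : IsBoundedBilinearMap ℝ fun p : A × A => s p.1 p.2)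
    (ht : IsBoundedBilinearMap ℝ fun p : B × B => t p.1 p.2) {f : C → ℝ} {g : A × B → ℝ}
    (hf : ContDiff ℝ 2 f) (hg : ContDiff ℝ 2 g) (c : ℝ)
    (hfg : ∀ p h : A × B, firstDeriv g p h =
      firstDeriv f (q p.1 p.2) (q p.1 h.2 + q h.1 p.2) + c * (s p.1 h.1 + t p.2 h.2))
    (p h : A × B) :
    hess g p h h = hess f (q p.1 p.2) (q p.1 h.2 + q h.1 p.2) (q p.1 h.2 + q h.1 p.2)
      + 2 * firstDeriv f (q p.1 p.2) (q h.1 h.2) + c * (s h.1 h.1 + t h.2 h.2) := by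
  have hdf : Differentiable ℝ (fderiv ℝ f) :=
    (hf.fderiv_right (m := 1) (by norm_num)).differentiable (by norm_num)
  have hdg : Differentiable ℝ (fderiv ℝ g) :=
    (hg.fderiv_right (m := 1) (by norm_num)).differentiable (by norm_num)
  have hl : HasFDerivAt (fun q => firstDeriv g q h)
      ((ContinuousLinearMap.apply ℝ ℝ h).comp (fderiv ℝ (fderiv ℝ g) p)) p :=
    (ContinuousLinearMap.apply ℝ ℝ h).hasFDerivAt.comp p (hdg p).hasFDerivAt
  have h1 : HasFDerivAt (fun p : A × B => fderiv ℝ f (q p.1 p.2)) _ p :=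
    (hdf (q p.1 p.2)).hasFDerivAt.comp p (hq.hasFDerivAt p)
  have h2 := (hq.hasFDerivAt (p.1, h.2)).comp p
    ((hasFDerivAt_fst (𝕜 := ℝ) (p := p)).prodMk (hasFDerivAt_const h.2 p))
  have h2' := (hq.hasFDerivAt (h.1, p.2)).comp p
    ((hasFDerivAt_const h.1 p).prodMk (hasFDerivAt_snd (𝕜 := ℝ) (p := p)))
  have h3 := (hs.hasFDerivAt (p.1, h.1)).comp p
    ((hasFDerivAt_fst (𝕜 := ℝ) (p := p)).prodMk (hasFDerivAt_const h.1 p))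
  have h3' := (ht.hasFDerivAt (p.2, h.2)).comp p
    ((hasFDerivAt_snd (𝕜 := ℝ) (p := p)).prodMk (hasFDerivAt_const h.2 p))
  have h4 := (h1.clm_apply (h2.add h2')).add ((h3.add h3').const_mul c)
  have h5 : (fun p => firstDeriv g p h) = _ := funext fun p => hfg p h
  rw [h5] at hl
  refine (DFunLike.congr_fun (hl.unique h4) h).trans ?_
  have z1 : ∀ a, q a 0 = 0 := fun a => by simpa using hq.smul_right 0 a 0
  have z2 : ∀ b, q 0 b = 0 := fun b => by simpa using hq.smul_left 0 0 b
  have z3 : ∀ a, s a 0 = 0 := fun a => by simpa using hs.smul_right 0 a 0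
  have z4 : ∀ a, t a 0 = 0 := fun a => by simpa using ht.smul_right 0 a 0
  simp [firstDeriv, hess, z1, z2, z3, z4]
  ring

end Bilinear

variable {n m r : ℕ}

lemma firstDeriv_eq_ip_grad (f : Matrix (Fin n) (Fin m) ℝ → ℝ) (X H : Matrix (Fin n) (Fin m) ℝ) :
    firstDeriv f X H = ip (grad f X) H := by
  rw [ip_eq_sum]
  conv_lhs => rw [Matrix.matrix_eq_sum_single H]
  simp only [firstDeriv, map_sum, grad, Matrix.of_apply]
  refine Finset.sum_congr rfl fun i _ => Finset.sum_congr rfl fun j _ => ?_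
  have : Matrix.single i j (H i j) = H i j • Matrix.single i j (1 : ℝ) := by
    rw [Matrix.smul_single, smul_eq_mul, mul_one]
  rw [this, map_smul, smul_eq_mul, mul_comm]

/-- The mixed Hessian of a function with restricted strong convexity and smoothness. -/
lemma HasRSCRSS.hess_ge {f : Matrix (Fin n) (Fin m) ℝ → ℝ} {κ₁ κ₂ a b : ℕ} {α β : ℝ}
    (hf : HasRSCRSS f κ₁ κ₂ α β) {X H K : Matrix (Fin n) (Fin m) ℝ} (hX : X.rank ≤ κ₁)
    (hH : H.rank ≤ a) (hK : K.rank ≤ b) (hab : a + b ≤ κ₂) :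
    (α + β) / 2 * ip H K - (β - α) / 2 * (‖H‖ * ‖K‖) ≤ hess f X H K := by
  rcases eq_or_ne H 0 with rfl | hH0
  · simp [hess, ip_zero_left]
  rcases eq_or_ne K 0 with rfl | hK0
  · simp [hess, ip_zero_right]
  have hp : 0 < ‖H‖ := norm_pos_iff.2 hH0
  have hq : 0 < ‖K‖ := norm_pos_iff.2 hK0
  -- Polarization is applied to ‖K‖H and ‖H‖K, which have equal norms, so the error term becomes the
  -- product ‖H‖‖K‖.
  have r1 : (‖K‖ • H + ‖H‖ • K).rank ≤ κ₂ :=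
    ((rank_add_le _ _).trans (add_le_add ((rank_smul_le _ _).trans hH)
      ((rank_smul_le _ _).trans hK))).trans hab
  have r2 : (‖K‖ • H - ‖H‖ • K).rank ≤ κ₂ :=
    ((rank_sub_le _ _).trans (add_le_add ((rank_smul_le _ _).trans hH)
      ((rank_smul_le _ _).trans hK))).trans hab
  have h1 := hf.rsc X _ hX r1
  have h2 := hf.rss X _ hX r2
  have h3 := hess_polarization hf.contDiff X H K ‖K‖ ‖H‖
  have hHH : ip H H = ‖H‖ ^ 2 := (norm_sq_eq_ip H).symm
  have hKK : ip K K = ‖K‖ ^ 2 := (norm_sq_eq_ip K).symm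
  have e1 : ‖‖K‖ • H + ‖H‖ • K‖ ^ 2 = 2 * ‖H‖ * ‖K‖ * (‖H‖ * ‖K‖ + ip H K) := by
    rw [norm_sq_eq_ip]
    simp only [ip_add_left, ip_add_right, ip_smul_left, ip_smul_right, ip_comm K H, hHH, hKK]
    ring
  have e2 : ‖‖K‖ • H - ‖H‖ • K‖ ^ 2 = 2 * ‖H‖ * ‖K‖ * (‖H‖ * ‖K‖ - ip H K) := by
    rw [norm_sq_eq_ip]
    simp only [ip_sub_left, ip_sub_right, ip_smul_left, ip_smul_right, ip_comm K H, hHH, hKK]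
    ring
  rw [e1] at h1
  rw [e2] at h2
  have hpq : 0 < 4 * ‖K‖ * ‖H‖ := by positivity
  refine le_of_mul_le_mul_left ?_ hpq
  rw [← h3]
  linarith

/-- Restricted co-coercivity of the gradient increment. -/
lemma HasRSCRSS.firstDeriv_sub_ge {f : Matrix (Fin n) (Fin m) ℝ → ℝ} {κ₁ κ₂ a b c : ℕ} {α β : ℝ}
    (hf : HasRSCRSS f κ₁ κ₂ α β) {X M H : Matrix (Fin n) (Fin m) ℝ} (hX : X.rank ≤ a)
    (hM : M.rank ≤ b) (hH : H.rank ≤ c) (hab : a + b ≤ κ₁) (habc : a + b + c ≤ κ₂) :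
    (α + β) / 2 * ip (X - M) H - (β - α) / 2 * (‖X - M‖ * ‖H‖) ≤
      firstDeriv f X H - firstDeriv f M H := by
  obtain ⟨t, ht⟩ := exists_hess_eq_firstDeriv_sub hf.contDiff M (X - M) H
  rw [add_sub_cancel] at ht
  rw [ht]
  refine hf.hess_ge (a := a + b) (b := c) ?_ ((rank_sub_le X M).trans (add_le_add hX hM)) hH habc
  have : M + t • (X - M) = t • X + (1 - t) • M := by
    rw [smul_sub, sub_smul, one_smul]; abel
  rw [this]
  exact ((rank_add_le _ _).trans (add_le_add ((rank_smul_le _ _).trans hX)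
      ((rank_smul_le _ _).trans hM))).trans hab

lemma HasRSCRSS.firstDeriv_sub_self_ge {f : Matrix (Fin n) (Fin m) ℝ → ℝ} {κ₁ κ₂ a b : ℕ}
    {α β : ℝ} (hf : HasRSCRSS f κ₁ κ₂ α β) {X M : Matrix (Fin n) (Fin m) ℝ} (hX : X.rank ≤ a)
    (hM : M.rank ≤ b) (hab : a + b ≤ κ₁) (hab' : a + b ≤ κ₂) :
    α * ‖X - M‖ ^ 2 ≤ firstDeriv f X (X - M) - firstDeriv f M (X - M) := by
  obtain ⟨t, ht⟩ := exists_hess_eq_firstDeriv_sub hf.contDiff M (X - M) (X - M)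
  rw [add_sub_cancel] at ht
  rw [ht]
  refine hf.rsc _ _ ?_ (((rank_sub_le X M).trans (add_le_add hX hM)).trans hab')
  have : M + t • (X - M) = t • X + (1 - t) • M := by
    rw [smul_sub, sub_smul, one_smul]; abel
  rw [this]
  exact ((rank_add_le _ _).trans (add_le_add ((rank_smul_le _ _).trans hX)
      ((rank_smul_le _ _).trans hM))).trans hab

lemma isBoundedBilinearMap_ip (n m : ℕ) : IsBoundedBilinearMap ℝ
    fun p : Matrix (Fin n) (Fin m) ℝ × Matrix (Fin n) (Fin m) ℝ => ip p.1 p.2 where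
  add_left := ip_add_left
  smul_left := ip_smul_left
  add_right := ip_add_right
  smul_right := ip_smul_right
  bound := ⟨1, one_pos, fun A B => by simpa using abs_ip_le A B⟩

lemma isBoundedBilinearMap_mul_transpose (n m r : ℕ) : IsBoundedBilinearMap ℝ
    fun p : Matrix (Fin n) (Fin r) ℝ × Matrix (Fin m) (Fin r) ℝ => p.1 * p.2ᵀ where
  add_left A B _ := Matrix.add_mul A B _
  smul_left c A _ := Matrix.smul_mul c A _
  add_right A B C := by simp only [Matrix.transpose_add, Matrix.mul_add]
  smul_right c A B := by simp only [Matrix.transpose_smul, Matrix.mul_smul]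
  bound := ⟨1, one_pos, fun A B => by
    simpa [Matrix.frobenius_norm_transpose] using Matrix.frobenius_norm_mul A Bᵀ⟩

lemma contDiff_Phi {f : Matrix (Fin n) (Fin m) ℝ → ℝ} (hf : ContDiff ℝ 2 f) (lam : ℝ) :
    ContDiff ℝ 2 (Phi (r := r) f lam) := by
  have h1 := hf.comp (isBoundedBilinearMap_mul_transpose n m r).contDiff
  have h2 : ContDiff ℝ 2 (fun p : Matrix (Fin n) (Fin r) ℝ × Matrix (Fin m) (Fin r) ℝ =>
      ip p.1 p.1) :=
    (isBoundedBilinearMap_ip n r).contDiff.comp (contDiff_fst.prodMk contDiff_fst)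
  have h3 : ContDiff ℝ 2 (fun p : Matrix (Fin n) (Fin r) ℝ × Matrix (Fin m) (Fin r) ℝ =>
      ip p.2 p.2) :=
    (isBoundedBilinearMap_ip m r).contDiff.comp (contDiff_snd.prodMk contDiff_snd)
  have h4 := h1.add ((contDiff_const (c := lam / 2)).mul (h2.add h3))
  have h5 : Phi (r := r) f lam = fun p => f (p.1 * p.2ᵀ) + lam / 2 * (ip p.1 p.1 + ip p.2 p.2) := by
    funext p
    simp only [Phi, norm_sq_eq_ip]
  rw [h5]
  exact h4

lemma firstDeriv_Phi {f : Matrix (Fin n) (Fin m) ℝ → ℝ} (hf : Differentiable ℝ f) (lam : ℝ)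
    (p h : Matrix (Fin n) (Fin r) ℝ × Matrix (Fin m) (Fin r) ℝ) :
    firstDeriv (Phi f lam) p h = firstDeriv f (p.1 * p.2ᵀ) (h.1 * p.2ᵀ + p.1 * h.2ᵀ)
      + lam * (ip p.1 h.1 + ip p.2 h.2) := by
  rw [add_comm (h.1 * p.2ᵀ)]
  have h5 : Phi (r := r) f lam = fun p => f (p.1 * p.2ᵀ) + lam / 2 * (ip p.1 p.1 + ip p.2 p.2) := by
    funext p
    simp only [Phi, norm_sq_eq_ip]
  rw [h5]
  refine (firstDeriv_comp_bilinear_add_sq (q := fun A B => A * Bᵀ)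
    (isBoundedBilinearMap_mul_transpose n m r) (isBoundedBilinearMap_ip n r)
    (isBoundedBilinearMap_ip m r) hf ip_comm ip_comm p h).trans ?_
  rw [mul_div_cancel₀ lam two_ne_zero]

lemma hess_Phi {f : Matrix (Fin n) (Fin m) ℝ → ℝ} (hf : ContDiff ℝ 2 f) (lam : ℝ)
    (p h : Matrix (Fin n) (Fin r) ℝ × Matrix (Fin m) (Fin r) ℝ) :
    hess (Phi f lam) p h h =
      hess f (p.1 * p.2ᵀ) (h.1 * p.2ᵀ + p.1 * h.2ᵀ) (h.1 * p.2ᵀ + p.1 * h.2ᵀ)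
        + 2 * firstDeriv f (p.1 * p.2ᵀ) (h.1 * h.2ᵀ) + lam * (ip h.1 h.1 + ip h.2 h.2) := by
  rw [add_comm (h.1 * p.2ᵀ)]
  exact hess_of_firstDeriv_eq (q := fun A B => A * Bᵀ) (isBoundedBilinearMap_mul_transpose n m r)
    (isBoundedBilinearMap_ip n r) (isBoundedBilinearMap_ip m r) hf (contDiff_Phi hf lam) lam
    (fun p h => by rw [firstDeriv_Phi (hf.differentiable (by norm_num)), add_comm (h.1 * p.2ᵀ)])
    p h

end Calculus

/-! ### Balanced factors from the singular value decomposition -/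

section BalancedFactors

variable {n m : ℕ}

lemma sing_nonneg (M : Matrix (Fin n) (Fin m) ℝ) (k : ℕ) : 0 ≤ sing M k :=
  LinearMap.singularValues_nonneg _ _

lemma sing_eq_zero_of_rank_le {M : Matrix (Fin n) (Fin m) ℝ} {k : ℕ} (hk : M.rank ≤ k) :
    sing M k = 0 := by
  rw [sing, LinearMap.singularValues_eq_zero_iff_le_finrank_range]
  rwa [Matrix.rank_eq_finrank_range_toLin M (PiLp.basisFun 2 ℝ (Fin n))
    (PiLp.basisFun 2 ℝ (Fin m)), ← Matrix.toLpLin_eq_toLin] at hk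

lemma submatrix_castLE_gram {s : ℕ} (hn : s ≤ n) {P : Matrix (Fin n) (Fin n) ℝ}
    (hP : P ∈ Matrix.orthogonalGroup (Fin n) ℝ) :
    (P.submatrix id (Fin.castLE hn))ᵀ * P.submatrix id (Fin.castLE hn) = 1 := by
  rw [Matrix.transpose_submatrix, ← Matrix.submatrix_mul _ _ _ id _ Function.bijective_id,
    show Pᵀ * P = 1 from (Matrix.mem_orthogonalGroup_iff' (Fin n) ℝ).1 hP]
  exact Matrix.submatrix_one _ (Fin.castLE_injective hn)

lemma submatrix_castLE_mul_diagonal_mul {s : ℕ} (hn : s ≤ n) (hm : s ≤ m)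
    (P : Matrix (Fin n) (Fin n) ℝ) (Q : Matrix (Fin m) (Fin m) ℝ) {z : ℕ → ℝ}
    (hz : ∀ k, s ≤ k → z k = 0) :
    P.submatrix id (Fin.castLE hn) * Matrix.diagonal (fun k : Fin s => z k) *
      (Q.submatrix id (Fin.castLE hm))ᵀ = P * rectDiag n m z * Qᵀ := by
  have hsub : ∀ {l : ℕ} (hl : s ≤ l) (A : Matrix (Fin l) (Fin l) ℝ),
      A.submatrix id (Fin.castLE hl) =
        A * (1 : Matrix (Fin l) (Fin l) ℝ).submatrix id (Fin.castLE hl) := by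
    intro l hl A
    ext i j
    simp [Matrix.mul_apply, Matrix.one_apply]
  have hmid : (1 : Matrix (Fin n) (Fin n) ℝ).submatrix id (Fin.castLE hn) *
      Matrix.diagonal (fun k : Fin s => z k) *
      ((1 : Matrix (Fin m) (Fin m) ℝ).submatrix id (Fin.castLE hm))ᵀ = rectDiag n m z := by
    ext a b
    rw [Matrix.mul_apply]
    simp only [Matrix.mul_diagonal, Matrix.submatrix_apply,
      Matrix.transpose_apply, Matrix.one_apply, id, rectDiag, Matrix.of_apply]
    by_cases hab : (a : ℕ) = b
    · rw [if_pos hab]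
      by_cases has : (a : ℕ) < s
      · rw [Finset.sum_eq_single ⟨a, has⟩]
        · simp [Fin.ext_iff, hab]
        · intro k _ hk
          have : a ≠ Fin.castLE hn k := fun h => hk (by simp [h])
          simp [this]
        · simp
      · rw [hz a (not_lt.1 has)]
        refine Finset.sum_eq_zero fun k _ => ?_
        have : a ≠ Fin.castLE hn k := fun h => has (by simp [h])
        simp [this]
    · rw [if_neg hab]
      refine Finset.sum_eq_zero fun k _ => ?_
      by_cases h1 : a = Fin.castLE hn k
      · have : b ≠ Fin.castLE hm k := fun h => hab (by simp [h1, h])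
        simp [this]
      · simp [h1]
  rw [hsub hn P, hsub hm Q, Matrix.transpose_mul, ← hmid]
  simp only [Matrix.mul_assoc]

/-- Balanced factors factor the matrix and have equal Gram matrices. -/
lemma balancedFactors_spec {M : Matrix (Fin n) (Fin m) ℝ} {s : ℕ} (hM : M.rank = s)
    {U : Matrix (Fin n) (Fin s) ℝ} {V : Matrix (Fin m) (Fin s) ℝ}
    (h : (U, V) ∈ balancedFactors M s) : U * Vᵀ = M ∧ Uᵀ * U = Vᵀ * V := by
  obtain ⟨hn, hm, ⟨P, Q⟩, ⟨hP, hQ, hsvd⟩, R, hR, hU, hV⟩ := h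
  simp only at hP hQ hsvd hU hV
  subst hU hV
  have hRR : R * Rᵀ = 1 := (Matrix.mem_orthogonalGroup_iff (Fin s) ℝ).1 hR
  set D := Matrix.diagonal (fun k : Fin s => √(sing M k)) with hD
  have hDD : D * D = Matrix.diagonal (fun k : Fin s => sing M k) := by
    rw [hD, Matrix.diagonal_mul_diagonal]
    simp only [Real.mul_self_sqrt (sing_nonneg M _)]
  have hDT : Dᵀ = D := Matrix.diagonal_transpose _
  have gram : ∀ {l : ℕ} (A : Matrix (Fin l) (Fin s) ℝ), Aᵀ * A = 1 →
      (A * D * R)ᵀ * (A * D * R) = Rᵀ * (D * D) * R := by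
    intro l A hA
    calc (A * D * R)ᵀ * (A * D * R) = Rᵀ * (Dᵀ * ((Aᵀ * A) * D)) * R := by
          simp only [Matrix.transpose_mul, Matrix.mul_assoc]
      _ = _ := by rw [hA, Matrix.one_mul, hDT]
  constructor
  · have hz : ∀ k, s ≤ k → sing M k = 0 := fun k hk => sing_eq_zero_of_rank_le (hM.trans_le hk)
    conv_rhs => rw [hsvd, ← submatrix_castLE_mul_diagonal_mul hn hm P Q hz, ← hDD]
    rw [Matrix.transpose_mul, Matrix.transpose_mul, hDT]
    calc _ = P.submatrix id (Fin.castLE hn) * D * (R * Rᵀ) *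
          (D * (Q.submatrix id (Fin.castLE hm))ᵀ) := by simp only [Matrix.mul_assoc]
      _ = _ := by rw [hRR, Matrix.mul_one]; simp only [Matrix.mul_assoc]
  · rw [gram _ (submatrix_castLE_gram hn hP), gram _ (submatrix_castLE_gram hm hQ)]

end BalancedFactors

/-! ### The error bound -/

section ErrorBound

variable {n m r : ℕ}

/-- The scalar estimate combining the first and second order conditions. -/
lemma sq_le_of_order_conditions {α β d e p x w : ℝ} (hα : 0 < α) (hαβ : α ≤ β)
    (hβ : β ≤ 1.38 * α) (hd : 0 ≤ d) (hp : 0 ≤ p) (hx : 0 ≤ x)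
    (h1 : (α + β) / 4 * p ^ 2 ≤ (β - α) / 2 * (d * p) + x * p)
    (h2 : 2 * α * d ^ 2 - 2 * x * e ≤ β * w) (h3 : w ≤ 1 / 8 * e ^ 2 + 17 / 4 * p ^ 2)
    (h4 : e ^ 2 ≤ 4 * d ^ 2) (h5 : 2 * d ^ 2 ≤ e ^ 2) :
    e ^ 2 ≤ 130000 / α ^ 2 * x ^ 2 := by
  -- Rescaling x by α lets α cancel, so that only the ratio β/α matters.
  obtain ⟨y, rfl⟩ : ∃ y, x = α * y := ⟨x / α, by field_simp⟩
  have hy : 0 ≤ y := by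
    by_contra h
    nlinarith [not_le.1 h]
  have hpb : p ≤ 0.32 * d + 2 * y := by
    rcases hp.eq_or_lt with rfl | hp'
    · positivity
    have hlin : (α + β) / 4 * p ≤ (β - α) / 2 * d + α * y := by
      refine le_of_mul_le_mul_right ?_ hp'
      nlinarith [h1]
    -- At β = 1.38α the ratio 2(β − α)/(α + β) is 0.76/2.38 < 0.32.
    have h6 : (β - α) / 2 * d ≤ (α + β) / 4 * (0.32 * d) := by
      have : (β - α) / 2 ≤ (α + β) / 4 * 0.32 := by norm_num at hβ ⊢; linarith
      nlinarith [mul_le_mul_of_nonneg_right this hd]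
    have h7 : α * y ≤ (α + β) / 4 * (2 * y) := by
      nlinarith [mul_le_mul_of_nonneg_right hαβ hy]
    refine le_of_mul_le_mul_left (a := (α + β) / 4) ?_ (by linarith)
    linarith
  have hp2 : p ^ 2 ≤ 0.052224 * e ^ 2 + 204 * y ^ 2 := by
    have h8 : p ^ 2 ≤ (0.32 * d + 2 * y) ^ 2 := pow_le_pow_left₀ hp hpb 2
    -- Young with weights 1.02 and 51: nearly all the slack must stay with d. Then d² ≤ e²/2 gives
    -- 1.02 · 0.32²/2 = 0.052224.
    have h9 : (0.32 * d + 2 * y) ^ 2 ≤ 1.02 * (0.32 * d) ^ 2 + 51 * (2 * y) ^ 2 := by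
      nlinarith [sq_nonneg (0.32 * d - 50 * (2 * y))]
    nlinarith
  have hw : β * w ≤ 1.38 * α * (1 / 8 * e ^ 2 + 17 / 4 * (0.052224 * e ^ 2 + 204 * y ^ 2)) := by
    have h10 : w ≤ 1 / 8 * e ^ 2 + 17 / 4 * (0.052224 * e ^ 2 + 204 * y ^ 2) := by linarith
    have h11 : 0 ≤ 1 / 8 * e ^ 2 + 17 / 4 * (0.052224 * e ^ 2 + 204 * y ^ 2) := by positivity
    calc β * w ≤ β * (1 / 8 * e ^ 2 + 17 / 4 * (0.052224 * e ^ 2 + 204 * y ^ 2)) :=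
          mul_le_mul_of_nonneg_left h10 (hα.le.trans hαβ)
      _ ≤ _ := mul_le_mul_of_nonneg_right hβ h11
  have hmain : 2 * d ^ 2 - 2 * y * e ≤
      1.38 * (1 / 8 * e ^ 2 + 17 / 4 * (0.052224 * e ^ 2 + 204 * y ^ 2)) := by
    refine le_of_mul_le_mul_left (a := α) ?_ hα
    linarith
  have hfin : e ^ 2 ≤ 130000 * y ^ 2 := by
    norm_num at hmain
    -- The coefficient of e² on the right is 1.38(1/8 + 17/4 · 0.052224) ≈ 0.479, against 1/2 on the
    -- left from e² ≤ 4d². The cross term 2ye costs a further 0.01.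
    nlinarith [sq_nonneg (e - 100 * y)]
  calc e ^ 2 ≤ 130000 * y ^ 2 := hfin
    _ = 130000 / α ^ 2 * (α * y) ^ 2 := by field_simp

lemma IsCritical.firstDeriv_eq_zero {E : Type*} [NormedAddCommGroup E] [NormedSpace ℝ E]
    {g : E → ℝ} {x : E} (hx : IsCritical g x) (h : E) : firstDeriv g x h = 0 := by
  rw [firstDeriv, show fderiv ℝ g x = 0 from hx, zero_apply]

/-- A critical point of the regularized objective is balanced. -/
lemma balanced_of_critical {f : Matrix (Fin n) (Fin m) ℝ → ℝ} {lam : ℝ}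
    (hlam : 0 < lam) {U : Matrix (Fin n) (Fin r) ℝ} {V : Matrix (Fin m) (Fin r) ℝ}
    (hc : ∀ (Y : Matrix (Fin n) (Fin r) ℝ) (Z : Matrix (Fin m) (Fin r) ℝ),
      firstDeriv f (U * Vᵀ) (Y * Vᵀ + U * Zᵀ) + lam * (ip U Y + ip V Z) = 0) :
    Uᵀ * U = Vᵀ * V := by
  set A := Uᵀ * U - Vᵀ * V with hA
  have hAT : Aᵀ = A := by simp [hA]
  -- This direction is tangent to the curve (U exp(tA), V exp(−tA)), along which UVᵀ is constant;
  -- only the regularizer varies, with derivative λ‖A‖².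
  have h := hc (U * A) (-(V * A))
  have h0 : U * A * Vᵀ + U * (-(V * A))ᵀ = 0 := by
    rw [Matrix.transpose_neg, Matrix.transpose_mul, hAT, Matrix.mul_neg, Matrix.mul_assoc]
    abel
  rw [h0] at h
  have h1 : ip A A = 0 := by
    have e1 : ip U (U * A) = ip (Uᵀ * U) A := by
      rw [ip_comm, ip_mul_left, ip_comm]
    have e2 : ip V (V * A) = ip (Vᵀ * V) A := by
      rw [ip_comm, ip_mul_left, ip_comm]
    rw [ip_neg_right, e1, e2, ← sub_eq_add_neg, ← ip_sub_left, ← hA] at h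
    simpa [firstDeriv, hlam.ne'] using h
  rw [← norm_sq_eq_ip, sq_eq_zero_iff, norm_eq_zero, hA, sub_eq_zero] at h1
  exact h1

/-- The error bound for a critical point satisfying the second order condition, with respect to a
balanced factorization aligned with it. -/
lemma gram_error_sq_le_of_aligned {f : Matrix (Fin n) (Fin m) ℝ → ℝ} {rs : ℕ} {α β lam : ℝ}
    (hβα : β ≤ 1.38 * α) (hf : HasRSCRSS f (2 * rs) (4 * rs) α β) (hlam : 0 < lam)
    {U Us : Matrix (Fin n) (Fin r) ℝ} {V Vs : Matrix (Fin m) (Fin r) ℝ}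
    (hb' : Usᵀ * Us = Vsᵀ * Vs) (hM : (Us * Vsᵀ).rank ≤ rs)
    (hal : ((Matrix.fromRows U V)ᵀ * Matrix.fromRows Us Vs).PosSemidef)
    (hcrit : IsCritical (Phi f lam) (U, V)) (hX : (U * Vᵀ).rank ≤ rs)
    (hpsd : HessPSD (Phi f lam) (U, V)) :
    ‖Matrix.fromRows U V * (Matrix.fromRows U V)ᵀ
        - Matrix.fromRows Us Vs * (Matrix.fromRows Us Vs)ᵀ‖ ^ 2 ≤
      130000 / α ^ 2 * (√rs * specNorm (Xi f lam (Us * Vsᵀ))) ^ 2 := by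
  have hdf : Differentiable ℝ f := hf.contDiff.differentiable (by norm_num)
  have hc : ∀ (Y : Matrix (Fin n) (Fin r) ℝ) (Z : Matrix (Fin m) (Fin r) ℝ),
      firstDeriv f (U * Vᵀ) (Y * Vᵀ + U * Zᵀ) + lam * (ip U Y + ip V Z) = 0 := by
    intro Y Z
    have := firstDeriv_Phi hdf lam (U, V) (Y, Z)
    rw [← this, hcrit.firstDeriv_eq_zero]
  have hb := balanced_of_critical hlam hc
  have hU : U.rank ≤ rs := (rank_left_le_of_balanced hb).trans hX
  have hV : V.rank ≤ rs := (rank_right_le_of_balanced hb).trans hX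
  have hW : (Matrix.fromRows U V).rank ≤ rs := (rank_fromRows_le_of_balanced hb).trans hX
  have hB : (Matrix.fromRows Us Vs).rank ≤ rs := (rank_fromRows_le_of_balanced hb').trans hM
  have hH : ∀ (Y : Matrix (Fin n) (Fin r) ℝ) (Z : Matrix (Fin m) (Fin r) ℝ),
      (Y * Vᵀ + U * Zᵀ).rank ≤ 2 * rs := fun Y Z => by
    have h1 := Matrix.rank_mul_le_right Y Vᵀ
    have h2 := Matrix.rank_mul_le_left U Zᵀ
    rw [Matrix.rank_transpose] at h1
    have h3 := rank_add_le (Y * Vᵀ) (U * Zᵀ)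
    omega
  have hXi : ∀ (A : Matrix (Fin n) (Fin r) ℝ) (B : Matrix (Fin m) (Fin r) ℝ)
      (Y : Matrix (Fin n) (Fin r) ℝ) (Z : Matrix (Fin m) (Fin r) ℝ),
      ip (Xi f lam (Us * Vsᵀ)) (Matrix.fromRows Y Z * (Matrix.fromRows A B)ᵀ) =
      lam * (ip A Y + ip B Z) + firstDeriv f (Us * Vsᵀ) (Y * Bᵀ + A * Zᵀ) := by
    intro A B Y Z
    rw [firstDeriv_eq_ip_grad]
    exact ip_xi_block lam _ A B Y Z
  have hσ := specNorm_nonneg (Xi f lam (Us * Vsᵀ))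
  obtain ⟨P, C, hPT, hPP, hPW, hPC, -⟩ := exists_range_projection (Matrix.fromRows U V)
  have hmain := norm_sub_mul_transpose_le _ _ P hPT hPP hPW hal
  have hE4 := norm_sq_gram_sub_le U V Us Vs hb hb'
  have hE2 := two_mul_norm_sq_sub_le U V Us Vs
  -- Since P = Pᵀ = CᵀWᵀ, the rows of E Cᵀ supply the variation.
  obtain ⟨Y, Z, hYZ⟩ : ∃ (Y : Matrix (Fin n) (Fin r) ℝ) (Z : Matrix (Fin m) (Fin r) ℝ),
      Matrix.fromRows Y Z * (Matrix.fromRows U V)ᵀ =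
      (Matrix.fromRows U V * (Matrix.fromRows U V)ᵀ
        - Matrix.fromRows Us Vs * (Matrix.fromRows Us Vs)ᵀ) * P := by
    refine ⟨Matrix.toRows₁ ((Matrix.fromRows U V * (Matrix.fromRows U V)ᵀ
        - Matrix.fromRows Us Vs * (Matrix.fromRows Us Vs)ᵀ) * Cᵀ),
      Matrix.toRows₂ ((Matrix.fromRows U V * (Matrix.fromRows U V)ᵀ
        - Matrix.fromRows Us Vs * (Matrix.fromRows Us Vs)ᵀ) * Cᵀ), ?_⟩
    rw [Matrix.fromRows_toRows, Matrix.mul_assoc, ← Matrix.transpose_mul, ← hPC, hPT]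
  have hhalf := norm_sq_mul_projection_le U V Us Vs Y Z hb hb' hPT hPP hPW hPC hYZ
  have hHn := norm_add_sq_le_of_balanced U V Y Z hb
  have hxi1 := hXi U V Y Z
  -- The ranks rs + rs of X − M and 2rs of the direction exhaust the allowance 4rs.
  have hinc := hf.firstDeriv_sub_ge hX hM (hH Y Z) (by omega) (by omega)
  have hcYZ := hc Y Z
  have hrk : ((Matrix.fromRows U V * (Matrix.fromRows U V)ᵀ
        - Matrix.fromRows Us Vs * (Matrix.fromRows Us Vs)ᵀ) * P).rank ≤ rs := by
    rw [← hYZ]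
    exact (Matrix.rank_mul_le_right _ _).trans ((Matrix.rank_transpose _).trans_le hW)
  have hdual := abs_ip_le_specNorm (Xi f lam (Us * Vsᵀ)) _ hrk
  rw [hYZ] at hHn hxi1
  -- The bound 4rs is not tight; it makes the square root come out as 2√rs.
  have hrkE : (Matrix.fromRows U V * (Matrix.fromRows U V)ᵀ
        - Matrix.fromRows Us Vs * (Matrix.fromRows Us Vs)ᵀ).rank ≤ 4 * rs := by
    have h1 := Matrix.rank_mul_le_left (Matrix.fromRows U V) (Matrix.fromRows U V)ᵀ
    have h2 := Matrix.rank_mul_le_left (Matrix.fromRows Us Vs) (Matrix.fromRows Us Vs)ᵀ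
    have h3 := rank_sub_le (Matrix.fromRows U V * (Matrix.fromRows U V)ᵀ)
      (Matrix.fromRows Us Vs * (Matrix.fromRows Us Vs)ᵀ)
    omega
  have hdualE := abs_ip_le_specNorm (Xi f lam (Us * Vsᵀ)) _ hrkE
  have hsqrt : √((4 * rs : ℕ) : ℝ) = 2 * √rs := by
    rw [Nat.cast_mul, Real.sqrt_mul (by positivity)]
    congr 1
    rw [show ((4 : ℕ) : ℝ) = 2 ^ 2 by norm_num, Real.sqrt_sq (by norm_num)]
  rw [hsqrt] at hdualE
  have hxiE : ip (Xi f lam (Us * Vsᵀ)) (Matrix.fromRows U V * (Matrix.fromRows U V)ᵀ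
        - Matrix.fromRows Us Vs * (Matrix.fromRows Us Vs)ᵀ) =
      lam * (ip U U + ip V V - ip Us Us - ip Vs Vs)
        + 2 * firstDeriv f (Us * Vsᵀ) (U * Vᵀ - Us * Vsᵀ) := by
    rw [ip_sub_right, hXi, hXi]
    simp only [firstDeriv, map_add, map_sub]
    ring
  have hconv := hf.firstDeriv_sub_self_ge hX hM (by omega) (by omega)
  have hDn := norm_add_sq_le_of_balanced U V (U - Us) (V - Vs) hb
  have hWD : Matrix.fromRows (U - Us) (V - Vs) =
      Matrix.fromRows U V - Matrix.fromRows Us Vs := by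
    ext (i | i) j <;> rfl
  rw [hWD] at hDn
  have hrss := hf.rss (U * Vᵀ) ((U - Us) * Vᵀ + U * (V - Vs)ᵀ) (by omega)
    ((hH _ _).trans (by omega))
  have hsec : 0 ≤ hess (Phi f lam) (U, V) (U - Us, V - Vs) (U - Us, V - Vs) := hpsd _
  rw [hess_Phi hf.contDiff] at hsec
  simp only at hsec
  have hcD := hc (U - Us) (V - Vs)
  -- The second-order product term is the tangent direction minus X − M. Stationarity removes the
  -- former, and strong convexity bounds the derivative along the latter.
  have hprod : (U - Us) * (V - Vs)ᵀ =
      ((U - Us) * Vᵀ + U * (V - Vs)ᵀ) - (U * Vᵀ - Us * Vsᵀ) := by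
    rw [Matrix.transpose_sub, Matrix.mul_sub, Matrix.mul_sub, Matrix.sub_mul, Matrix.sub_mul]
    abel
  rw [hprod] at hsec
  have hfd : firstDeriv f (U * Vᵀ)
      (((U - Us) * Vᵀ + U * (V - Vs)ᵀ) - (U * Vᵀ - Us * Vsᵀ)) =
      firstDeriv f (U * Vᵀ) ((U - Us) * Vᵀ + U * (V - Vs)ᵀ)
        - firstDeriv f (U * Vᵀ) (U * Vᵀ - Us * Vsᵀ) := by
    simp only [firstDeriv, map_sub]
  rw [hfd] at hsec
  have hip : ∀ {k : ℕ} (A B : Matrix (Fin k) (Fin r) ℝ),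
      ip (A - B) (A - B) = 2 * ip A (A - B) + ip B B - ip A A := by
    intro k A B
    simp only [ip_sub_left, ip_sub_right, ip_comm B A]
    ring
  rw [hip U, hip V] at hsec
  refine sq_le_of_order_conditions (β := β) (d := ‖U * Vᵀ - Us * Vsᵀ‖)
    (p := ‖(Matrix.fromRows U V * (Matrix.fromRows U V)ᵀ
        - Matrix.fromRows Us Vs * (Matrix.fromRows Us Vs)ᵀ) * P‖)
    (w := ‖(Matrix.fromRows U V - Matrix.fromRows Us Vs) * (Matrix.fromRows U V)ᵀ‖ ^ 2)
    hf.pos hf.le hβα (norm_nonneg _) (norm_nonneg _) (by positivity) ?_ ?_ hmain hE4 hE2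
  · have hHn' := le_of_sq_le_sq hHn (norm_nonneg _)
    have h1 : (β - α) / 2 * (‖U * Vᵀ - Us * Vsᵀ‖ * ‖Y * Vᵀ + U * Zᵀ‖) ≤
        (β - α) / 2 * (‖U * Vᵀ - Us * Vsᵀ‖ * ‖(Matrix.fromRows U V * (Matrix.fromRows U V)ᵀ
        - Matrix.fromRows Us Vs * (Matrix.fromRows Us Vs)ᵀ) * P‖) := by
      have := hf.le
      have : 0 ≤ (β - α) / 2 := by linarith
      gcongr
    have h2 := mul_le_mul_of_nonneg_left hhalf (by linarith [hf.pos, hf.le] : 0 ≤ (α + β) / 4)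
    have h3 := (neg_le_abs _).trans hdual
    linarith
  · have h1 := (neg_le_abs _).trans hdualE
    have h2 := mul_le_mul_of_nonneg_left hDn (hf.pos.le.trans hf.le)
    linarith

/-- Factors can be padded and rotated so that they are aligned with a given one. -/
lemma exists_aligned_factor {I : Type*} [Fintype I] {s : ℕ} (hs : s ≤ r)
    (W : Matrix I (Fin r) ℝ) (B : Matrix I (Fin s) ℝ) :
    ∃ T : Matrix (Fin s) (Fin r) ℝ, T * Tᵀ = 1 ∧ (Wᵀ * (B * T)).PosSemidef := by
  -- K consists of the first s columns of the identity, so multiplying by Kᵀ pads B with zero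
  -- columns.
  have hK := submatrix_castLE_gram hs (one_mem (Matrix.orthogonalGroup (Fin r) ℝ))
  set K := (1 : Matrix (Fin r) (Fin r) ℝ).submatrix id (Fin.castLE hs)
  obtain ⟨R, hR, hpsd⟩ := exists_orthogonal_mul_posSemidef (Wᵀ * (B * Kᵀ))
  have hRR : R * Rᵀ = 1 := (Matrix.mem_orthogonalGroup_iff (Fin r) ℝ).1 hR
  refine ⟨Kᵀ * R, ?_, ?_⟩
  · calc Kᵀ * R * (Kᵀ * R)ᵀ = Kᵀ * (R * Rᵀ) * K := by
          simp only [Matrix.transpose_mul, Matrix.transpose_transpose, Matrix.mul_assoc]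
      _ = 1 := by rw [hRR, Matrix.mul_one, hK]
  · simpa only [Matrix.mul_assoc] using hpsd

lemma mul_mul_transpose_of_coisometry {I J K L : Type*} [Fintype K] [Fintype L] [DecidableEq K]
    {T : Matrix K L ℝ} (hT : T * Tᵀ = 1) (A : Matrix I K ℝ) (B : Matrix J K ℝ) :
    A * T * (B * T)ᵀ = A * Bᵀ := by
  rw [Matrix.transpose_mul, Matrix.mul_assoc, ← Matrix.mul_assoc T, hT, Matrix.one_mul]

end ErrorBound

end LowRank

/-! ### Assembly of the theorem -/

theorem mainTheorem1 (α β : ℝ) (hβα : β / α ≤ 1.38) :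
    ∃ γ : ℝ, 0 < γ ∧
      ∀ (n m r rs : ℕ) (f : Matrix (Fin n) (Fin m) ℝ → ℝ) (M : Matrix (Fin n) (Fin m) ℝ)
        (lam : ℝ) (U : Matrix (Fin n) (Fin r) ℝ) (V : Matrix (Fin m) (Fin r) ℝ)
        (Us : Matrix (Fin n) (Fin rs) ℝ) (Vs : Matrix (Fin m) (Fin rs) ℝ),
        M.rank = rs → rs ≤ r →
        LowRank.HasRSCRSS f (2 * rs) (4 * rs) α β →
        0 < lam →
        (Us, Vs) ∈ LowRank.balancedFactors M rs →
        LowRank.IsCritical (LowRank.Phi f lam) (U, V) →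
        (U * Vᵀ).rank ≤ rs →
        LowRank.HessPSD (LowRank.Phi f lam) (U, V) →
        2 * ‖U * Vᵀ - M‖ ^ 2 ≤
            ‖Matrix.fromRows U V * (Matrix.fromRows U V)ᵀ
              - Matrix.fromRows Us Vs * (Matrix.fromRows Us Vs)ᵀ‖ ^ 2 ∧
          ‖Matrix.fromRows U V * (Matrix.fromRows U V)ᵀ
              - Matrix.fromRows Us Vs * (Matrix.fromRows Us Vs)ᵀ‖ ^ 2 ≤
            γ * rs * LowRank.specNorm (LowRank.Xi f lam M) ^ 2 ∧
          γ * rs * LowRank.specNorm (LowRank.Xi f lam M) ^ 2 ≤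
            2 * γ * rs * (lam ^ 2 + LowRank.specNorm (LowRank.grad f M) ^ 2) := by
  -- For α ≤ 0 no f satisfies `HasRSCRSS`, so any positive constant serves.
  rcases le_or_gt α 0 with hα | hα
  · exact ⟨1, one_pos, fun n m r rs f M lam U V Us Vs _ _ hf => absurd hf.pos (not_lt.2 hα)⟩
  refine ⟨130000 / α ^ 2, by positivity, ?_⟩
  intro n m r rs f M lam U V Us Vs hM hrs hf hlam hbal hcrit hX hpsd
  obtain ⟨hfac, hb⟩ := LowRank.balancedFactors_spec hM hbal
  subst hfac
  refine ⟨LowRank.two_mul_norm_sq_sub_le U V Us Vs, ?_, ?_⟩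
  -- Replacing the factors by their products with T gives them r columns and alignment with W.
  -- Because TTᵀ = 1, neither M nor the Gram matrix BBᵀ changes.
  · obtain ⟨T, hT, hal⟩ := LowRank.exists_aligned_factor hrs (Matrix.fromRows U V)
      (Matrix.fromRows Us Vs)
    rw [Matrix.fromRows_mul] at hal
    have hb' : (Us * T)ᵀ * (Us * T) = (Vs * T)ᵀ * (Vs * T) := by
      calc (Us * T)ᵀ * (Us * T) = Tᵀ * (Usᵀ * Us) * T := by
            simp only [Matrix.transpose_mul, Matrix.mul_assoc]
        _ = _ := by rw [hb]; simp only [Matrix.transpose_mul, Matrix.mul_assoc]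
    have hfac := LowRank.mul_mul_transpose_of_coisometry hT Us Vs
    have h := LowRank.gram_error_sq_le_of_aligned ((div_le_iff₀ hα).1 hβα) hf hlam hb'
      (by rw [hfac, hM]) hal hcrit hX hpsd
    rw [hfac, ← Matrix.fromRows_mul, LowRank.mul_mul_transpose_of_coisometry hT, mul_pow,
      Real.sq_sqrt (Nat.cast_nonneg rs), ← mul_assoc] at h
    exact h
  · have h := LowRank.specNorm_xi_block_sq_le lam (LowRank.grad f (Us * Vsᵀ))
    calc _ ≤ 130000 / α ^ 2 * rs *
          (2 * (lam ^ 2 + LowRank.specNorm (LowRank.grad f (Us * Vsᵀ)) ^ 2)) :=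
          mul_le_mul_of_nonneg_left h (by positivity)
      _ = _ := by ring
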